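/- Let $X_1, X_2, \ldots$ be i.i.d. real random variables, $Z_0 = 0$, $Z_n = X_1 + \cdots + X_n$, and write $\overline F(x) = \mathbb P(X_1 > x)$. Let $N = \inf\{n > 0 : Z_n > 0\}$ and $\widehat N = \inf\{n > 0 : Z_n \le 0\}$ (with $\inf\emptyset = \infty$), and write $\mathbb P(Z_N \in dy)$ for the measure $A \mapsto \mathbb P(N < \infty,\ Z_N \in A)$. Assume that $\widehat N < \infty$ almost surely, that the weak descending ladder height $-Z_{\widehat N} \ge 0$ has finite mean $m = \mathbb E(-Z_{\widehat N}) < \infty$, and that the law of $X_1$ is non-lattice, that is, not concentrated on $h\mathbb Z$ for any $h > 0$. Then the following are equivalent. (i) The law of $X_1$ is long-tailed: $\overline F(x) > 0$ for every $x > 0$, and $\lim_{x \to \infty} \overline F(x+t)/\overline F(x) = 1$ for each $t \in \mathbb R$. (ii) For every (Borel) directly Riemann integrable $g : [0,\infty) \to [0,\infty)$, $$\lim_{x \to \infty} \frac{1}{\overline F(x)} \int_{(x,\infty)} g(y - x)\, \mathbb P(Z_N \in dy) = \frac1m \int_0^\infty g(z)\, dz .$$ Here $g$ is directly Riemann integrable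 if, with $\overline S_h = h\sum_{n \ge 0} \sup_{[nh,(n+1)h)} g$ and $\underline S_h = h\sum_{n \ge 0} \inf_{[nh,(n+1)h)} g$, one has $\overline S_h < \infty$ for all $h > 0$ and $\overline S_h - \underline S_h \to 0$ as $h \downarrow 0$. -/

import Mathlib

open MeasureTheory ProbabilityTheory Filter Topology Set

noncomputable section

/-- The right tail `x ↦ μ ]x, ∞[` of a measure on the line. -/
def rightTail (μ : Measure ℝ) (x : ℝ) : ℝ := μ.real (Ioi x)

/-- The class `𝓛⁰` of long-tailed measures: the right tail is positive and finite at every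
`x > 0`, and `μ ]x + t, ∞[ / μ ]x, ∞[ → 1` as `x → ∞`, for each real `t`. -/
def LongTailed (μ : Measure ℝ) : Prop :=
  (∀ x : ℝ, 0 < x → 0 < μ (Ioi x) ∧ μ (Ioi x) < ⊤) ∧
    ∀ t : ℝ, Tendsto (fun x : ℝ => rightTail μ (x + t) / rightTail μ x) atTop (𝓝 1)

/-- A law on the line is non-lattice if it is not concentrated on `h ℤ` for any `h > 0`. -/
def NonLattice (μ : Measure ℝ) : Prop :=
  ¬ ∃ h : ℝ, 0 < h ∧ ∀ᵐ x ∂μ, ∃ k : ℤ, x = k * h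

/-- The upper Riemann sum over `[0, ∞[` with mesh `h`. -/
def upperSum (g : ℝ → ℝ) (h : ℝ) : ENNReal :=
  ∑' n : ℕ, ENNReal.ofReal h * ⨆ y ∈ Ico (n * h) ((n + 1) * h), ENNReal.ofReal (g y)

/-- The lower Riemann sum over `[0, ∞[` with mesh `h`. -/
def lowerSum (g : ℝ → ℝ) (h : ℝ) : ENNReal :=
  ∑' n : ℕ, ENNReal.ofReal h * ⨅ y ∈ Ico (n * h) ((n + 1) * h), ENNReal.ofReal (g y)

/-- Direct Riemann integrability of a nonnegative function on `[0, ∞[` (the values of `g` on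
the negative half-line play no role). -/
def DirectlyRiemannIntegrable (g : ℝ → ℝ) : Prop :=
  (∀ x : ℝ, 0 ≤ x → 0 ≤ g x) ∧
    (∀ h : ℝ, 0 < h → upperSum g h < ⊤) ∧
    Tendsto (fun h : ℝ => upperSum g h - lowerSum g h) (𝓝[>] 0) (𝓝 0)

/-- The random walk `Z₀ = 0`, `Zₙ = X₁ + ⋯ + Xₙ`; the step `Xₖ` is `X (k - 1)`. -/
def randomWalk {Ω : Type*} (X : ℕ → Ω → ℝ) (n : ℕ) (ω : Ω) : ℝ :=
  ∑ k ∈ Finset.range n, X k ω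

/-- The first strict ascending ladder epoch `N = inf {n > 0 : Zₙ > 0}`, equal to `∞` if there is
no such `n`. -/
def ascEpoch {Ω : Type*} (X : ℕ → Ω → ℝ) (ω : Ω) : ℕ∞ :=
  ⨅ (n : ℕ) (_ : 0 < n ∧ 0 < randomWalk X n ω), (n : ℕ∞)

/-- The first weak descending ladder epoch `N̂ = inf {n > 0 : Zₙ ≤ 0}`, equal to `∞` if there is
no such `n`. -/
def descEpoch {Ω : Type*} (X : ℕ → Ω → ℝ) (ω : Ω) : ℕ∞ :=
  ⨅ (n : ℕ) (_ : 0 < n ∧ randomWalk X n ω ≤ 0), (n : ℕ∞)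

/-- The measure `A ↦ ℙ(N < ∞, Z_N ∈ A)`, of total mass `ℙ(N < ∞) ≤ 1`. -/
def ascLadderLaw {Ω : Type*} [MeasurableSpace Ω] (P : Measure Ω) (X : ℕ → Ω → ℝ) : Measure ℝ :=
  (P.restrict {ω | ascEpoch X ω < ⊤}).map fun ω => randomWalk X (ascEpoch X ω).toNat ω

/-- The weak descending ladder height `-Z_N̂ ≥ 0`, meaningful where `N̂ < ∞`. -/
def descHeight {Ω : Type*} (X : ℕ → Ω → ℝ) (ω : Ω) : ℝ :=
  -randomWalk X (descEpoch X ω).toNat ω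

end

/-! Write `μ` for the step law, `h` for the law of the weak descending ladder position, and `U` for
the occupation measure of the walk before it first enters `(0, ∞)`. Splitting at the entering step
shows that the law of `Z_N` is `μ ∗ U` restricted to `(0, ∞)` (`exitLaw_Ioi`). Duality makes `U` the
renewal measure of `h`: `U = δ₀ + h ∗ U` (`occupation_eq`). The non-lattice property passes from `μ`
to `h` (`nonLattice_exitLaw`), which also forces `m > 0`. The renewal theorem `tendsto_integral_add`
then shows that `Z t = ∫ z (t + u) dU` tends to `(∫ z) / m` for continuous compactly supported `z ≥
0`.

The renewal theorem is proved from the equation `Z t = z t + ∫ Z (t + y) dh`. Where `Z` is near its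
upper limit it must also be near it after a shift by any point of the support of `h`, hence by the
semigroup which these points generate. Far out that semigroup is nearly dense, so `Z` is near its
upper limit on long intervals. The conserved quantity `∫ y in Ioi 0, Z (t - y) * h (Iio (-y)) = ∫ z`
(from `lintegral_tail_mul`) then identifies the upper limit, and the same argument for `-Z`
identifies the lower limit.

For (i) ⇒ (ii), integrating `z (y - x)` against `μ ∗ U` gives `∫ Z (w - x) dμ`. Here `Z` vanishes
far to the left and is nearly constant far to the right, and a long-tailed `μ` charges bounded
windows around `x` by `o(rightTail μ x)` only. Step functions extend the limit to directly Riemann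
integrable `g`. For (ii) ⇒ (i), translates of one tent function have the same limit, and comparing
the normalisations at `x` and `x + t` gives the tail ratio (`longTailed_of_tendsto`). -/

/-! ### Killed walks and exit laws on the line -/

/-- The law at time `n` of a walk with step law `μ` started at `0` and killed on its first exit
from `B` at a positive time. -/
noncomputable def killedLaw (μ : Measure ℝ) (B : Set ℝ) : ℕ → Measure ℝ
  | 0 => Measure.dirac 0
  | n + 1 => (killedLaw μ B n ∗ μ).restrict B

/-- The law of the position of the walk at its first exit from `Cᶜ`. -/
noncomputable def exitLaw (μ : Measure ℝ) (C : Set ℝ) : Measure ℝ :=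
  Measure.sum fun n => (killedLaw μ Cᶜ n ∗ μ).restrict C

/-- The first positive time at which the walk is in `C`. -/
noncomputable def entryEpoch {Ω : Type*} (X : ℕ → Ω → ℝ) (C : Set ℝ) (ω : Ω) : ℕ∞ :=
  ⨅ (n : ℕ) (_ : 0 < n ∧ randomWalk X n ω ∈ C), (n : ℕ∞)

/-- The event that the walk avoids `C` at the times `1, …, n`. -/
def avoids {Ω : Type*} (X : ℕ → Ω → ℝ) (C : Set ℝ) (n : ℕ) : Set Ω :=
  {ω | ∀ k, 0 < k → k ≤ n → randomWalk X k ω ∉ C}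

instance isFiniteMeasure_killedLaw (μ : Measure ℝ) [IsFiniteMeasure μ] (B : Set ℝ) (n : ℕ) :
    IsFiniteMeasure (killedLaw μ B n) := by
  induction n with
  | zero => unfold killedLaw; infer_instance
  | succ n ih => unfold killedLaw; infer_instance

/-! ### From ladder epochs of the random walk to exit laws -/

section walk

variable {Ω : Type*} {X : ℕ → Ω → ℝ} {C : Set ℝ}

lemma entryEpoch_eq_succ {ω : Ω} {n : ℕ} :
    entryEpoch X C ω = ((n + 1 : ℕ) : ℕ∞) ↔ ω ∈ avoids X C n ∧ randomWalk X (n + 1) ω ∈ C := by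
  constructor
  · intro h
    have hlow : ∀ k, 0 < k → randomWalk X k ω ∈ C → n + 1 ≤ k := fun k hk hkC => by
      have : entryEpoch X C ω ≤ k := iInf₂_le k ⟨hk, hkC⟩
      rw [h] at this
      exact_mod_cast this
    refine ⟨fun k hk hkn hkC => by have := hlow k hk hkC; omega, ?_⟩
    by_contra hn
    have : ((n + 2 : ℕ) : ℕ∞) ≤ entryEpoch X C ω := by
      refine le_iInf₂ fun k hk => ?_
      have h1 := hlow k hk.1 hk.2
      have h2 : k ≠ n + 1 := by rintro rfl; exact hn hk.2
      exact_mod_cast (by omega : n + 2 ≤ k)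
    rw [h] at this
    have : n + 2 ≤ n + 1 := by exact_mod_cast this
    omega
  · rintro ⟨h1, h2⟩
    refine le_antisymm (iInf₂_le (n + 1) ⟨by omega, h2⟩) (le_iInf₂ fun k hk => ?_)
    have : n + 1 ≤ k := by
      by_contra hlt
      exact h1 k hk.1 (by omega) hk.2
    exact_mod_cast this

lemma entryEpoch_pos (ω : Ω) : 0 < entryEpoch X C ω := by
  have : (1 : ℕ∞) ≤ entryEpoch X C ω := le_iInf₂ fun k hk => by exact_mod_cast hk.1
  exact lt_of_lt_of_le zero_lt_one this

/-- The event that the walk enters `C` for the first time at time `n + 1`. -/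
def entersAt {Ω : Type*} (X : ℕ → Ω → ℝ) (C : Set ℝ) (n : ℕ) : Set Ω :=
  {ω | entryEpoch X C ω = ((n + 1 : ℕ) : ℕ∞)}

lemma entersAt_eq (n : ℕ) : entersAt X C n = randomWalk X (n + 1) ⁻¹' C ∩ avoids X C n := by
  ext ω
  simp only [entersAt, mem_ofPred_eq, entryEpoch_eq_succ, mem_inter_iff, mem_preimage]
  tauto

lemma entryEpoch_lt_top_eq : {ω | entryEpoch X C ω < ⊤} = ⋃ n, entersAt X C n := by
  ext ω
  simp only [mem_ofPred_eq, mem_iUnion, entersAt]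
  constructor
  · intro h
    obtain ⟨k, hk⟩ := ENat.ne_top_iff_exists.1 h.ne
    have hpos := entryEpoch_pos (X := X) (C := C) ω
    rw [← hk] at hpos
    have : 0 < k := by exact_mod_cast hpos
    exact ⟨k - 1, by rw [← hk, Nat.sub_add_cancel this]⟩
  · rintro ⟨n, hn⟩
    rw [hn]; exact ENat.natCast_lt_top _

variable [MeasurableSpace Ω] {P : Measure Ω}

lemma measurable_randomWalk (hX : ∀ n, Measurable (X n)) (n : ℕ) :
    Measurable (randomWalk X n) :=
  Finset.measurable_sum _ fun i _ => hX i

lemma measurableSet_avoids (hX : ∀ n, Measurable (X n)) (hC : MeasurableSet C) (n : ℕ) :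
    MeasurableSet (avoids X C n) := by
  have : avoids X C n = ⋂ k, ⋂ (_ : 0 < k), ⋂ (_ : k ≤ n), (randomWalk X k) ⁻¹' Cᶜ := by
    ext ω; simp [avoids]
  rw [this]
  exact .iInter fun k => .iInter fun _ => .iInter fun _ => measurable_randomWalk hX k hC.compl

lemma measurableSet_entersAt (hX : ∀ n, Measurable (X n)) (hC : MeasurableSet C) (n : ℕ) :
    MeasurableSet (entersAt X C n) := by
  rw [entersAt_eq]
  exact (measurable_randomWalk hX _ hC).inter (measurableSet_avoids hX hC n)

lemma measurable_randomWalk_entryEpoch (hX : ∀ n, Measurable (X n)) (hC : MeasurableSet C) :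
    Measurable fun ω => randomWalk X (entryEpoch X C ω).toNat ω := by
  have hsucc : ∀ n : ℕ, (fun ω => (entryEpoch X C ω).toNat) ⁻¹' {n + 1} = entersAt X C n := by
    intro n
    ext ω
    simp only [mem_preimage, mem_singleton_iff, entersAt, mem_ofPred_eq]
    constructor
    · intro h
      rw [← h, ENat.natCast_toNat]
      intro htop
      simp [htop] at h
    · intro h; rw [h]; rfl
  have hnat : Measurable fun ω => (entryEpoch X C ω).toNat := by
    refine measurable_to_countable' fun n => ?_
    cases n with
    | succ n => rw [hsucc]; exact measurableSet_entersAt hX hC n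
    | zero =>
      have : (fun ω => (entryEpoch X C ω).toNat) ⁻¹' {0} = (⋃ n, entersAt X C n)ᶜ := by
        ext ω
        simp only [← hsucc, mem_preimage, mem_singleton_iff, mem_compl_iff, mem_iUnion]
        constructor
        · rintro h ⟨n, hn⟩; omega
        · intro h
          by_contra h0
          exact h ⟨(entryEpoch X C ω).toNat - 1, by omega⟩
      rw [this]
      exact (MeasurableSet.iUnion fun n => measurableSet_entersAt hX hC n).compl
  have hw : Measurable fun p : ℕ × Ω => randomWalk X p.1 p.2 :=
    measurable_from_prod_countable_right fun n => measurable_randomWalk hX n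
  exact hw.comp (hnat.prodMk measurable_id)

variable [IsProbabilityMeasure P]

/-- The event of avoiding `C` up to time `n` depends only on the steps before `X n`, so the next
step is independent of it and of the current position. -/
lemma map_randomWalk_succ_restrict_avoids (hX : ∀ n, Measurable (X n)) (hindep : iIndepFun X P)
    (hident : ∀ n, IdentDistrib (X n) (X 0) P P) (hC : MeasurableSet C) (n : ℕ) :
    (P.restrict (avoids X C n)).map (randomWalk X (n + 1)) =
      (P.restrict (avoids X C n)).map (randomWalk X n) ∗ P.map (X 0) := by
  set m : ℕ → MeasurableSpace Ω := fun i => MeasurableSpace.comap (X i) inferInstance with hm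
  have hle : ∀ i, m i ≤ ‹MeasurableSpace Ω› := fun i => (hX i).comap_le
  -- Step `X n` moves the walk from time `n` to `n + 1`; the past is generated by the indices below
  -- `n`.
  have hI : Indep (⨆ i ∈ Iio n, m i) (⨆ i ∈ ({n} : Set ℕ), m i) P :=
    indep_iSup_of_disjoint hle hindep (by simp)
  have hpast : ∀ k ≤ n, Measurable[⨆ i ∈ Iio n, m i] (randomWalk X k) := by
    intro k hk
    refine @Finset.measurable_sum _ _ _ _ _ _ _ _ _ fun i hi => ?_
    have hi' : i ∈ Iio n := (Finset.mem_range.1 hi).trans_le hk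
    exact Measurable.mono (comap_measurable (X i)) (le_iSup₂ (f := fun i _ => m i) i hi') le_rfl
  have hav : MeasurableSet[⨆ i ∈ Iio n, m i] (avoids X C n) := by
    have : avoids X C n = ⋂ k, ⋂ (_ : 0 < k), ⋂ (_ : k ≤ n), (randomWalk X k) ⁻¹' Cᶜ := by
      ext ω; simp [avoids]
    rw [this]
    exact .iInter fun k => .iInter fun _ => .iInter fun hk => hpast k hk hC.compl
  have hZ := measurable_randomWalk hX
  have hA := measurableSet_avoids hX hC n
  have hprod : ((P.restrict (avoids X C n)).map (randomWalk X n)).prod (P.map (X 0)) =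
      (P.restrict (avoids X C n)).map fun ω => (randomWalk X n ω, X n ω) := by
    have : IsProbabilityMeasure (P.map (X 0)) := Measure.isProbabilityMeasure_map (hX 0).aemeasurable
    refine Measure.prod_eq fun s t hs ht => ?_
    rw [Measure.map_apply ((hZ n).prodMk (hX n)) (hs.prod ht), Measure.map_apply (hZ n) hs,
      Measure.restrict_apply (((hZ n).prodMk (hX n)) (hs.prod ht)),
      Measure.restrict_apply (hZ n hs), ← (hident n).map_eq, Measure.map_apply (hX n) ht,
      ← (Indep_iff _ _ P).1 hI _ _ (MeasurableSet.inter (hpast n le_rfl hs) hav)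
        (le_iSup₂ (f := fun i _ => m i) n (mem_singleton n) _ ⟨t, ht, rfl⟩)]
    congr 1
    ext ω
    simp only [mem_inter_iff, mem_preimage, mem_prod]
    tauto
  rw [Measure.conv, hprod, Measure.map_map (by fun_prop) ((hZ n).prodMk (hX n))]
  congr 1
  ext ω
  simp [randomWalk, Finset.sum_range_succ]

lemma map_randomWalk_restrict_avoids (hX : ∀ n, Measurable (X n)) (hindep : iIndepFun X P)
    (hident : ∀ n, IdentDistrib (X n) (X 0) P P) (hC : MeasurableSet C) (n : ℕ) :
    (P.restrict (avoids X C n)).map (randomWalk X n) = killedLaw (P.map (X 0)) Cᶜ n := by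
  induction n with
  | zero =>
    have : avoids X C 0 = univ := by
      ext ω
      simp only [avoids, mem_ofPred_eq, mem_univ, iff_true]
      intro k h1 h2; omega
    rw [this, Measure.restrict_univ]
    have : randomWalk X 0 = fun _ : Ω => (0 : ℝ) := by ext; simp [randomWalk]
    rw [this, Measure.map_const]
    simp [killedLaw]
  | succ n ih =>
    have hsplit : avoids X C (n + 1) = randomWalk X (n + 1) ⁻¹' Cᶜ ∩ avoids X C n := by
      ext ω
      simp only [avoids, mem_ofPred_eq, mem_inter_iff, mem_preimage, mem_compl_iff]
      constructor
      · exact fun h => ⟨h _ (by omega) le_rfl, fun k h1 h2 => h k h1 (by omega)⟩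
      · rintro ⟨h1, h2⟩ k hk hkn
        rcases hkn.eq_or_lt with rfl | hlt
        · exact h1
        · exact h2 k hk (by omega)
    have hZ := measurable_randomWalk hX (n + 1)
    rw [hsplit, ← Measure.restrict_restrict (hZ hC.compl), ← Measure.restrict_map hZ hC.compl,
      map_randomWalk_succ_restrict_avoids hX hindep hident hC, ih, killedLaw]

lemma map_randomWalk_entryEpoch (hX : ∀ n, Measurable (X n)) (hindep : iIndepFun X P)
    (hident : ∀ n, IdentDistrib (X n) (X 0) P P) (hC : MeasurableSet C) :
    (P.restrict {ω | entryEpoch X C ω < ⊤}).map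
      (fun ω => randomWalk X (entryEpoch X C ω).toNat ω) = exitLaw (P.map (X 0)) C := by
  have hmeas := measurable_randomWalk_entryEpoch hX hC
  have hdisj : Pairwise (Function.onFun Disjoint (entersAt X C)) := by
    intro i j hij
    refine disjoint_left.2 fun ω hi hj => hij ?_
    have : ((i + 1 : ℕ) : ℕ∞) = ((j + 1 : ℕ) : ℕ∞) := hi.symm.trans hj
    have : i + 1 = j + 1 := by exact_mod_cast this
    omega
  rw [entryEpoch_lt_top_eq, Measure.restrict_iUnion hdisj (measurableSet_entersAt hX hC),
    Measure.map_sum hmeas.aemeasurable, exitLaw]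
  congr 1
  ext1 n
  have hZ := measurable_randomWalk hX (n + 1)
  rw [← map_randomWalk_restrict_avoids hX hindep hident hC,
    ← map_randomWalk_succ_restrict_avoids hX hindep hident hC, Measure.restrict_map hZ hC,
    Measure.restrict_restrict (hZ hC), ← entersAt_eq]
  refine Measure.map_congr ?_
  filter_upwards [ae_restrict_mem (measurableSet_entersAt hX hC n)] with ω hω
  rw [show entryEpoch X C ω = ((n + 1 : ℕ) : ℕ∞) from hω]
  rfl

lemma ascLadderLaw_eq_exitLaw (hX : ∀ n, Measurable (X n)) (hindep : iIndepFun X P)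
    (hident : ∀ n, IdentDistrib (X n) (X 0) P P) :
    ascLadderLaw P X = exitLaw (P.map (X 0)) (Ioi 0) :=
  map_randomWalk_entryEpoch hX hindep hident measurableSet_Ioi

lemma map_neg_descHeight_eq_exitLaw (hX : ∀ n, Measurable (X n)) (hindep : iIndepFun X P)
    (hident : ∀ n, IdentDistrib (X n) (X 0) P P) (hfin : ∀ᵐ ω ∂P, descEpoch X ω < ⊤) :
    P.map (fun ω => -descHeight X ω) = exitLaw (P.map (X 0)) (Iic 0) := by
  rw [← map_randomWalk_entryEpoch hX hindep hident measurableSet_Iic,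
    Measure.restrict_eq_self_of_ae_mem (s := {ω | entryEpoch X (Iic 0) ω < ⊤}) hfin]
  congr 1
  ext ω
  simp only [descHeight, neg_neg]
  rfl

lemma measurable_descHeight (hX : ∀ n, Measurable (X n)) : Measurable (descHeight X) :=
  (measurable_randomWalk_entryEpoch hX measurableSet_Iic).neg

end walk

/-! ### Wiener–Hopf duality: the occupation measure as a renewal measure -/

section wienerHopf

open scoped ENNReal

lemma conv_apply_eq_lintegral (a b : Measure ℝ) [SFinite b] {A : Set ℝ} (hA : MeasurableSet A) :
    (a ∗ b) A = ∫⁻ x, b ((fun y => x + y) ⁻¹' A) ∂a := by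
  rw [← lintegral_indicator_one hA, Measure.lintegral_conv (measurable_one.indicator hA)]
  refine lintegral_congr fun x => ?_
  rw [← lintegral_indicator_one (hA.preimage (measurable_const_add x))]
  rfl

lemma ae_conv_mem {a b : Measure ℝ} [SFinite b] {S T R : Set ℝ} (hR : MeasurableSet R)
    (ha : ∀ᵐ x ∂a, x ∈ S) (hb : ∀ᵐ y ∂b, y ∈ T) (h : ∀ x ∈ S, ∀ y ∈ T, x + y ∈ R) :
    ∀ᵐ z ∂(a ∗ b), z ∈ R := by
  change (a ∗ b) Rᶜ = 0
  rw [conv_apply_eq_lintegral _ _ hR.compl, lintegral_eq_zero_iff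
    (Measurable.lintegral_prod_right' (f := fun p : ℝ × ℝ => Rᶜ.indicator 1 (p.1 + p.2))
      (by exact (measurable_one.indicator hR.compl).comp measurable_add) |> fun h => by
        convert h using 2 with x
        rw [← lintegral_indicator_one (hR.compl.preimage (measurable_const_add x))]
        rfl)]
  filter_upwards [ha] with x hx
  have : ∀ᵐ y ∂b, x + y ∈ R := hb.mono fun y hy => h x hx y hy
  exact this

lemma mul_le_conv_apply {a b : Measure ℝ} [SFinite b] {S T R : Set ℝ} (hS : MeasurableSet S)
    (hR : MeasurableSet R) (h : ∀ x ∈ S, ∀ y ∈ T, x + y ∈ R) : a S * b T ≤ (a ∗ b) R := by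
  rw [conv_apply_eq_lintegral _ _ hR, mul_comm, ← setLIntegral_const]
  refine (setLIntegral_mono' hS fun x hx => measure_mono fun y hy => h x hx y hy).trans
    (setLIntegral_le_lintegral _ _)

lemma sum_conv_sum {ι κ : Type*} [Countable ι] [Countable κ] (a : ι → Measure ℝ)
    (b : κ → Measure ℝ) [∀ i, SFinite (a i)] [∀ k, SFinite (b k)] :
    Measure.sum a ∗ Measure.sum b = Measure.sum fun p : ι × κ => a p.1 ∗ b p.2 := by
  unfold Measure.conv
  rw [Measure.prod_sum, Measure.map_sum (by fun_prop)]

lemma finset_sum_conv {ι : Type*} (s : Finset ι) (a : ι → Measure ℝ) (b : Measure ℝ)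
    [∀ i, SFinite (a i)] [SFinite b] {A : Set ℝ} (hA : MeasurableSet A) :
    ((∑ i ∈ s, a i) ∗ b) A = ∑ i ∈ s, (a i ∗ b) A := by
  simp only [conv_apply_eq_lintegral _ _ hA]
  rw [lintegral_finsetSum_measure]

variable (μ : Measure ℝ)

lemma killedLaw_conv (B : Set ℝ) (hB : MeasurableSet B) (n : ℕ) :
    killedLaw μ B n ∗ μ = killedLaw μ B (n + 1) + (killedLaw μ B n ∗ μ).restrict Bᶜ :=
  (Measure.restrict_add_restrict_compl hB).symm

/-- The sub-law of the first weak descending ladder height on the event that its epoch is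
`n + 1`. -/
noncomputable def descLaw (n : ℕ) : Measure ℝ := (killedLaw μ (Ioi 0) n ∗ μ).restrict (Iic 0)

lemma exitLaw_Iic : exitLaw μ (Iic 0) = Measure.sum (descLaw μ) := by
  simp [exitLaw, compl_Iic]
  rfl

lemma ae_killedLaw_mem {B S : Set ℝ} (hB : MeasurableSet B) (h0 : 0 ∈ S) (hBS : B ⊆ S) (n : ℕ) : ∀ᵐ x ∂killedLaw μ B n, x ∈ S := by
  cases n with
  | zero => simpa [killedLaw] using h0
  | succ n => exact (ae_restrict_mem hB).mono fun x hx => hBS hx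

lemma ae_descLaw_nonpos (n : ℕ) : ∀ᵐ x ∂descLaw μ n, x ∈ Iic (0 : ℝ) :=
  ae_restrict_mem measurableSet_Iic

/-- The occupation measure before the first entry into `(0, ∞)`. -/
noncomputable def occupation : Measure ℝ := Measure.sum (killedLaw μ (Iic 0))

lemma ae_occupation_nonpos : ∀ᵐ x ∂occupation μ, x ∈ Iic (0 : ℝ) := by
  rw [occupation, Measure.ae_sum_iff]
  exact ae_killedLaw_mem μ measurableSet_Iic (by simp) subset_rfl

lemma ae_exitLaw_nonpos : ∀ᵐ x ∂exitLaw μ (Iic 0), x ∈ Iic (0 : ℝ) := by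
  rw [exitLaw_Iic, Measure.ae_sum_iff]
  exact ae_descLaw_nonpos μ

variable [IsProbabilityMeasure μ]

instance (n : ℕ) : IsFiniteMeasure (descLaw μ n) := by unfold descLaw; infer_instance

/-- The decomposition of the walk killed on entering `(0, ∞)`, seen backwards in time, at its
first weak descending ladder epoch. -/
lemma killedLaw_Iic_succ_apply (n : ℕ) {A : Set ℝ} (hA : MeasurableSet A) :
    killedLaw μ (Iic 0) (n + 1) A =
      ∑ p ∈ Finset.HasAntidiagonal.antidiagonal n, (descLaw μ p.1 ∗ killedLaw μ (Iic 0) p.2) A := by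
  set M := killedLaw μ (Iic 0) with hM
  set ν := killedLaw μ (Ioi 0) with hν
  set L : ℕ → Measure ℝ := fun n => (M n ∗ μ).restrict (Ioi 0) with hL
  -- Both sides are carried by `(-∞, 0]`; on subsets of it every term that lives on `(0, ∞)` drops
  -- out.
  wlog hA0 : A ⊆ Iic 0 generalizing A with H
  · have key : ∀ ρ : Measure ℝ, (∀ᵐ x ∂ρ, x ∈ Iic (0 : ℝ)) → ρ A = ρ (A ∩ Iic 0) := by
      intro ρ hρ
      refine measure_congr ?_
      filter_upwards [hρ] with x hx
      exact propext ⟨fun h => ⟨h, hx⟩, fun h => h.1⟩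
    rw [key _ (ae_killedLaw_mem μ measurableSet_Iic (by simp) subset_rfl _),
      H (hA.inter measurableSet_Iic) inter_subset_right]
    refine Finset.sum_congr rfl fun p _ => (key _ ?_).symm
    exact ae_conv_mem measurableSet_Iic (ae_descLaw_nonpos μ _)
      (ae_killedLaw_mem μ measurableSet_Iic (by simp) subset_rfl _)
      fun x hx y hy => mem_Iic.2 (add_nonpos hx hy)
  -- The middle step of `ν ∗ μ ∗ M` can extend the left factor or the right one; equating the two
  -- decompositions gives a telescoping identity.
  have step : ∀ p : ℕ × ℕ, (ν (p.1 + 1) ∗ M p.2) A + (descLaw μ p.1 ∗ M p.2) A =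
      (ν p.1 ∗ M (p.2 + 1)) A := by
    intro p
    have h1 : (ν p.1 ∗ μ) ∗ M p.2 = ν (p.1 + 1) ∗ M p.2 + descLaw μ p.1 ∗ M p.2 := by
      rw [killedLaw_conv μ _ measurableSet_Ioi, compl_Ioi, Measure.add_conv]
      rfl
    have h2 : (ν p.1 ∗ μ) ∗ M p.2 = ν p.1 ∗ M (p.2 + 1) + ν p.1 ∗ L p.2 := by
      rw [Measure.conv_assoc, Measure.conv_comm μ, killedLaw_conv μ _ measurableSet_Iic, compl_Iic,
        Measure.conv_add]
    have h3 : (ν p.1 ∗ L p.2) A = 0 := by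
      have : ∀ᵐ z ∂(ν p.1 ∗ L p.2), z ∈ Ioi (0 : ℝ) :=
        ae_conv_mem measurableSet_Ioi
          (ae_killedLaw_mem μ measurableSet_Ioi (by simp) Ioi_subset_Ici_self _)
          (ae_restrict_mem measurableSet_Ioi) fun x hx y hy => mem_Ioi.2 (add_pos_of_nonneg_of_pos hx hy)
      refine measure_mono_null (fun x hx => ?_) this
      simpa using hA0 hx
    have := congrArg (fun ρ : Measure ℝ => ρ A) (h1.symm.trans h2)
    simpa [h3] using this
  have hsum := Finset.sum_congr (rfl : Finset.HasAntidiagonal.antidiagonal n = _) fun p _ => step p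
  rw [Finset.sum_add_distrib] at hsum
  -- The same sum over the antidiagonal of `n + 1` is peeled at both ends; only the end terms `ν 0 ∗
  -- M (n + 1)` and `ν (n + 1) ∗ M 0` survive the telescoping, and the latter is null on `A`.
  have e1 := Finset.Nat.sum_antidiagonal_succ (n := n) (f := fun p => (ν p.1 ∗ M p.2) A)
  have e2 := Finset.Nat.sum_antidiagonal_succ' (n := n) (f := fun p => (ν p.1 ∗ M p.2) A)
  simp only [] at e1 e2
  have hν0 : (ν (n + 1) ∗ M 0) A = 0 := by
    have : M 0 = Measure.dirac 0 := rfl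
    rw [this, Measure.conv_dirac_zero]
    exact measure_mono_null (fun x hx => by simpa using hA0 hx)
      (ae_restrict_mem (measurableSet_Ioi (a := (0 : ℝ))) : ∀ᵐ x ∂ν (n + 1), x ∈ Ioi (0 : ℝ))
  have hM0 : (ν 0 ∗ M (n + 1)) A = M (n + 1) A := by
    have : ν 0 = Measure.dirac 0 := rfl
    rw [this, Measure.dirac_zero_conv]
  rw [hν0, zero_add, e1, hM0, ← hsum] at e2
  have hfin : ∑ p ∈ Finset.HasAntidiagonal.antidiagonal n, (ν (p.1 + 1) ∗ M p.2) A ≠ ∞ :=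
    ENNReal.sum_ne_top.2 fun p _ => measure_ne_top _ _
  rw [add_comm] at e2
  exact (ENNReal.add_right_inj hfin).1 e2

instance : SFinite (occupation μ) := by unfold occupation; infer_instance

instance : SFinite (exitLaw μ (Iic 0)) := by rw [exitLaw_Iic]; infer_instance

lemma exitLaw_Ioi : exitLaw μ (Ioi 0) = (occupation μ ∗ μ).restrict (Ioi 0) := by
  have h : occupation μ ∗ μ = Measure.sum fun n => killedLaw μ (Iic 0) n ∗ μ := by
    unfold occupation Measure.conv
    rw [Measure.prod_sum_left, Measure.map_sum (by fun_prop)]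
  rw [h, Measure.restrict_sum _ measurableSet_Ioi, exitLaw, compl_Ioi]

/-- The occupation measure is the renewal measure of the weak descending ladder heights. -/
lemma occupation_eq :
    occupation μ = Measure.dirac 0 + exitLaw μ (Iic 0) ∗ occupation μ := by
  ext A hA
  rw [exitLaw_Iic, occupation, sum_conv_sum, Measure.add_apply, Measure.sum_apply _ hA,
    Measure.sum_apply _ hA, tsum_eq_zero_add' ENNReal.summable]
  congr 1
  simp_rw [killedLaw_Iic_succ_apply μ _ hA]
  rw [← Equiv.tsum_eq (Finset.HasAntidiagonal.sigmaAntidiagonalEquivProd (A := ℕ)), ENNReal.tsum_sigma']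
  refine tsum_congr fun n => ?_
  exact (Finset.tsum_subtype' (Finset.HasAntidiagonal.antidiagonal n)
    fun p => (descLaw μ p.1 ∗ killedLaw μ (Iic 0) p.2) A).symm

/-- A renewal inequality for the partial sums. These are finite measures, so mass can be cancelled
before `U` is known to be locally finite. -/
lemma sum_killedLaw_le (n : ℕ) :
    ∑ k ∈ Finset.range n, killedLaw μ (Iic 0) k ≤
      Measure.dirac 0 + exitLaw μ (Iic 0) ∗ ∑ k ∈ Finset.range n, killedLaw μ (Iic 0) k := by
  refine Measure.le_iff.2 fun A hA => ?_
  rw [Measure.add_apply, Measure.conv_comm, finset_sum_conv _ _ _ hA, Measure.finsetSum_apply]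
  cases n with
  | zero => simp
  | succ n =>
  rw [Finset.sum_range_succ']
  rw [add_comm]
  refine add_le_add le_rfl ?_
  calc ∑ i ∈ Finset.range n, killedLaw μ (Iic 0) (i + 1) A
      = ∑ i ∈ Finset.range n, ∑ k ∈ Finset.range (i + 1),
          (descLaw μ (i - k) ∗ killedLaw μ (Iic 0) k) A := by
        refine Finset.sum_congr rfl fun i _ => ?_
        rw [killedLaw_Iic_succ_apply μ _ hA, ← Finset.Nat.sum_antidiagonal_swap,
          Finset.Nat.sum_antidiagonal_eq_sum_range_succ_mk]
        rfl
    _ = ∑ k ∈ Finset.range n, ∑ i ∈ Finset.Ico k n,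
          (descLaw μ (i - k) ∗ killedLaw μ (Iic 0) k) A := by
        refine Finset.sum_comm' fun i k => ?_
        simp only [Finset.mem_range, Finset.mem_Ico]; omega
    _ ≤ ∑ k ∈ Finset.range n, (killedLaw μ (Iic 0) k ∗ exitLaw μ (Iic 0)) A := by
        refine Finset.sum_le_sum fun k _ => ?_
        have : (killedLaw μ (Iic 0) k ∗ exitLaw μ (Iic 0)) A =
            ∑' j, (descLaw μ j ∗ killedLaw μ (Iic 0) k) A := by
          rw [exitLaw_Iic, Measure.conv_comm]
          unfold Measure.conv
          rw [Measure.prod_sum_left, Measure.map_sum (by fun_prop), Measure.sum_apply _ hA]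
        rw [this, Finset.sum_Ico_eq_sum_range]
        simp only [Nat.add_sub_cancel_left]
        exact ENNReal.sum_le_tsum _
    _ ≤ _ := Finset.sum_le_sum_of_subset (Finset.range_mono (Nat.le_succ n))

end wienerHopf

/-! ### Transfer of the non-lattice property to the ladder height -/

section lattice

variable (μ : Measure ℝ) [IsProbabilityMeasure μ]

/-- If the weak descending ladder height is a.s. in `a ℤ`, so is the step. -/
lemma nonLattice_exitLaw (hμ : NonLattice μ) [IsProbabilityMeasure (exitLaw μ (Iic 0))] :
    NonLattice (exitLaw μ (Iic 0)) := by
  rintro ⟨a, ha, hlat⟩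
  set G : Set ℝ := {x | ∃ k : ℤ, x = k * a} with hG
  have hGc : G.Countable := by
    have : G = range fun k : ℤ => (k : ℝ) * a := by ext; simp [hG, eq_comm]
    rw [this]; exact countable_range _
  have hGm : MeasurableSet G := hGc.measurableSet
  set ν := killedLaw μ (Ioi 0) with hν
  have hexit : ∀ n, (ν n ∗ μ) (Gᶜ ∩ Iic 0) = 0 := by
    intro n
    rw [exitLaw_Iic, Measure.ae_sum_iff] at hlat
    have : (descLaw μ n) Gᶜ = 0 := hlat n
    rwa [descLaw, Measure.restrict_apply hGm.compl] at this
  have hneg : μ (Gᶜ ∩ Iic 0) = 0 := by simpa [hν, killedLaw] using hexit 0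
  refine hμ ⟨a, ha, ?_⟩
  suffices hpos : μ (Gᶜ ∩ Ioi 0) = 0 by
    change μ Gᶜ = 0
    rw [← inter_univ Gᶜ, ← Iic_union_Ioi (a := (0 : ℝ)), inter_union_distrib_left]
    exact measure_union_null hneg hpos
  -- Without negative steps, a walk that has become positive never returns, so almost sure descent
  -- must occur at the first step, and `μ` does not charge `(0, ∞)`.
  by_cases hz : μ (Iio 0) = 0
  · have hzero : ∀ n, descLaw μ (n + 1) = 0 := by
      intro n
      have : ∀ᵐ z ∂(ν (n + 1) ∗ μ), z ∈ Ioi (0 : ℝ) :=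
        ae_conv_mem (T := Ici 0) measurableSet_Ioi (ae_restrict_mem measurableSet_Ioi)
          (by change μ (Ici 0)ᶜ = 0; rwa [compl_Ici])
          fun x hx y hy => mem_Ioi.2 (add_pos_of_pos_of_nonneg hx hy)
      refine Measure.restrict_eq_zero.2 (measure_mono_null (fun x hx => ?_) this)
      simpa using hx
    have h1 : exitLaw μ (Iic 0) univ = 1 := measure_univ
    rw [exitLaw_Iic, Measure.sum_apply _ .univ, tsum_eq_zero_add' ENNReal.summable] at h1
    simp only [hzero, Measure.coe_zero, Pi.zero_apply, tsum_zero, add_zero] at h1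
    simp only [descLaw, killedLaw, Measure.dirac_zero_conv, Measure.restrict_apply_univ] at h1
    have := (prob_compl_eq_zero_iff (measurableSet_Iic (a := (0 : ℝ)))).2 h1
    rw [compl_Iic] at this
    exact measure_mono_null inter_subset_right this
  -- Negative steps lie in the countable set `G`, so one of its points is a negative atom `b`.
  -- Repeating the step `b` carries an off-lattice positive position down to an off-lattice exit,
  -- which is impossible.
  · obtain ⟨b, hbG, hb0, hb⟩ : ∃ b ∈ G, b < 0 ∧ μ {b} ≠ 0 := by
      by_contra! hcon
      refine hz ?_
      have h1 : μ (G ∩ Iio 0) = 0 := by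
        rw [← biUnion_of_singleton (G ∩ Iio 0)]
        exact (measure_biUnion_null_iff (hGc.mono inter_subset_left)).2
          fun b hb => hcon b hb.1 hb.2
      have h2 : μ (Gᶜ ∩ Iio 0) = 0 :=
        measure_mono_null (inter_subset_inter_right _ Iio_subset_Iic_self) hneg
      refine measure_mono_null (fun x hx => ?_) (measure_union_null h1 h2)
      by_cases hxG : x ∈ G
      · exact Or.inl ⟨hxG, hx⟩
      · exact Or.inr ⟨hxG, hx⟩
    obtain ⟨j, rfl⟩ := hbG
    set b : ℝ := j * a with hbdef
    -- Off-lattice positive points which `k` steps `b` bring to `(-∞, 0]`; a single step maps `S (k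
    -- + 1)` into `S k` or to an off-lattice exit point.
    set S : ℕ → Set ℝ := fun k => Gᶜ ∩ Ioc 0 (-(k * b)) with hS
    have hSm : ∀ k, MeasurableSet (S k) := fun k => hGm.compl.inter measurableSet_Ioc
    have hnull : ∀ k n, ν n (S k) = 0 := by
      intro k
      induction k with
      | zero => intro n; simp [hS]
      | succ k ih =>
        intro n
        have h1 : (ν n ∗ μ) (S k) = 0 := by
          have := ih (n + 1)
          rw [hν, killedLaw, Measure.restrict_apply (hSm k)] at this
          refine measure_mono_null (fun x hx => ?_) this
          exact ⟨hx, hx.2.1⟩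
        have h2 := mul_le_conv_apply (a := ν n) (b := μ) (T := {b}) (hSm (k + 1))
          ((hGm.compl.inter measurableSet_Iic).union (hSm k)) (fun x hx y hy => by
            rw [mem_singleton_iff] at hy
            subst hy
            have hxb : x + b ∈ Gᶜ := by
              rintro ⟨i, hi⟩
              refine hx.1 ⟨i - j, ?_⟩
              push_cast
              rw [hbdef] at hi
              linarith
            have hx2 := hx.2.2
            push_cast at hx2
            rcases le_or_gt (x + b) 0 with h0 | h0
            · exact Or.inl ⟨hxb, h0⟩
            · exact Or.inr ⟨hxb, h0, by linarith⟩)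
        rw [measure_union_null (hexit n) h1, nonpos_iff_eq_zero, mul_eq_zero] at h2
        exact h2.resolve_right hb
    have hcover : Gᶜ ∩ Ioi 0 ⊆ ⋃ k, S k := by
      rintro x ⟨hxG, hx⟩
      obtain ⟨k, hk⟩ := exists_nat_ge (x / (-b))
      rw [div_le_iff₀ (by linarith)] at hk
      exact mem_iUnion.2 ⟨k, hxG, mem_Ioi.1 hx, by linarith⟩
    have h1 : ν 1 (Gᶜ ∩ Ioi 0) = 0 :=
      measure_mono_null hcover (measure_iUnion_null fun k => hnull k 1)
    rw [hν, killedLaw, killedLaw, Measure.dirac_zero_conv,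
      Measure.restrict_apply (hGm.compl.inter measurableSet_Ioi), inter_assoc, inter_self] at h1
    exact h1

end lattice

/-! ### Asymptotic density of the semigroup generated by the support -/

section support

variable {h : Measure ℝ}

/-- The semigroup generated by the support of a non-lattice law on `(-∞, 0]` is asymptotically
dense at `-∞`. -/
lemma NonLattice.exists_mem_closure_support (hnl : NonLattice h)
    (hneg : ∀ᵐ x ∂h, x ∈ Iic (0 : ℝ)) {ε : ℝ} (hε : 0 < ε) :
    ∃ L : ℝ, ∀ x ≥ L, ∃ s ∈ AddSubmonoid.closure h.support, |s + x| < ε := by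
  set S := AddSubmonoid.closure h.support with hS
  have hsupp : h.support ⊆ Iic 0 := Measure.support_subset_of_isClosed isClosed_Iic hneg
  have hSneg : ∀ s ∈ S, s ≤ 0 := by
    intro s hs
    induction hs using AddSubmonoid.closure_induction with
    | mem x hx => exact hsupp hx
    | zero => exact le_rfl
    | add x y _ _ hx hy => exact add_nonpos hx hy
  -- The difference group of the semigroup is dense, since a cyclic group would make `h` lattice.
  let G : AddSubgroup ℝ :=
    { carrier := {x | ∃ a ∈ S, ∃ b ∈ S, x = a - b}
      zero_mem' := ⟨0, S.zero_mem, 0, S.zero_mem, by simp⟩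
      add_mem' := by
        rintro _ _ ⟨a, ha, b, hb, rfl⟩ ⟨c, hc, d, hd, rfl⟩
        exact ⟨a + c, S.add_mem ha hc, b + d, S.add_mem hb hd, by ring⟩
      neg_mem' := by
        rintro _ ⟨a, ha, b, hb, rfl⟩
        exact ⟨b, hb, a, ha, by ring⟩ }
  have hsG : h.support ⊆ G := fun x hx =>
    ⟨x, AddSubmonoid.subset_closure hx, 0, S.zero_mem, by simp⟩
  have hdense : Dense (G : Set ℝ) := by
    refine G.dense_or_cyclic.resolve_right ?_
    rintro ⟨a, ha⟩
    have hmul : ∀ᵐ x ∂h, ∃ k : ℤ, x = k * a := by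
      filter_upwards [Measure.support_mem_ae (μ := h)] with x hx
      have hxG : x ∈ G := hsG hx
      rw [ha, AddSubgroup.mem_closure_singleton] at hxG
      obtain ⟨k, hk⟩ := hxG
      exact ⟨k, by simp [← hk]⟩
    rcases lt_trichotomy a 0 with h0 | h0 | h0
    · exact hnl ⟨-a, by linarith, hmul.mono fun x ⟨k, hk⟩ => ⟨-k, by rw [hk]; push_cast; ring⟩⟩
    · exact hnl ⟨1, one_pos, hmul.mono fun x ⟨k, hk⟩ => ⟨0, by rw [hk, h0]; simp⟩⟩
    · exact hnl ⟨a, h0, hmul⟩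
  obtain ⟨d, ⟨a, ha, b, hb, hd⟩, hdε⟩ := hdense.exists_between hε
  have hd0 : 0 < d := hdε.1
  have hb0 : b < 0 := by linarith [hSneg a ha]
  -- With `n` copies of `b` the sum falls below `-x` by less than `-b`; trading `k` copies of `b`
  -- for `a` raises it in increments `d < ε`. Having `n ≥ N ≥ -b / d` ensures that enough copies are
  -- available, i.e. `k ≤ n`.
  obtain ⟨N, hN⟩ := exists_nat_ge (-b / d)
  rw [div_le_iff₀ hd0] at hN
  refine ⟨N * -b, fun x hx => ?_⟩
  have hbpos : 0 < -b := by linarith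
  set n : ℕ := ⌈x / -b⌉₊ with hn
  have hx0 : 0 ≤ x := le_trans (by positivity) hx
  have hn1 : x ≤ n * -b := by
    have := Nat.le_ceil (x / -b)
    rwa [div_le_iff₀ hbpos] at this
  have hn2 : (n : ℝ) * -b < x + -b := by
    have := Nat.ceil_lt_add_one (show 0 ≤ x / -b by positivity)
    rw [← hn] at this
    have h1 := mul_lt_mul_of_pos_right this hbpos
    rwa [add_mul, div_mul_cancel₀ _ hbpos.ne', one_mul] at h1
  have hNn : (N : ℝ) ≤ n := by
    have : (N : ℝ) * -b ≤ n * -b := hx.le.trans hn1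
    exact le_of_mul_le_mul_right this hbpos
  set k : ℕ := ⌊(n * -b - x) / d⌋₊ with hk
  have hk0 : 0 ≤ (n * -b - x) / d := div_nonneg (by linarith) hd0.le
  have hk1 : (k : ℝ) * d ≤ n * -b - x := by
    have := Nat.floor_le hk0
    rwa [le_div_iff₀ hd0] at this
  have hk2 : (n : ℝ) * -b - x < k * d + d := by
    have := Nat.lt_floor_add_one ((n * -b - x) / d)
    rw [div_lt_iff₀ hd0] at this
    linarith
  have hkn : k ≤ n := by
    have : (k : ℝ) * d ≤ n * d := by
      have : (N : ℝ) * d ≤ n * d := mul_le_mul_of_nonneg_right hNn hd0.le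
      linarith
    exact_mod_cast le_of_mul_le_mul_right this hd0
  refine ⟨(n - k) • b + k • a, S.add_mem (S.nsmul_mem hb _) (S.nsmul_mem ha _), ?_⟩
  have : (n - k) • b + k • a = n * b + k * d := by
    simp only [nsmul_eq_mul, Nat.cast_sub hkn, hd]; ring
  rw [this, abs_lt]
  constructor <;> linarith [hdε.2]

end support

/-! ### Bounded solutions of the renewal equation near their upper limit -/

section renewalEquation

variable {h : Measure ℝ} [IsProbabilityMeasure h] {Z e : ℝ → ℝ} {B η : ℝ}

/-- If a bounded solution of the renewal equation tends to its upper limit along a filter, it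
does so along the filter translated by any point of the support of the step law. -/
lemma tendsto_add_of_mem_support (hZ : UniformContinuous Z) (hB : ∀ t, |Z t| ≤ B)
    (heq : ∀ t, Z t = e t + ∫ y, Z (t + y) ∂h) (he : Tendsto e atTop (𝓝 0))
    (hη : ∀ ε > 0, ∀ᶠ t in atTop, Z t ≤ η + ε) {l : Filter ℝ} (hl : l ≤ atTop)
    (hlZ : Tendsto Z l (𝓝 η)) {s : ℝ} (hs : s ∈ h.support) :
    Tendsto (fun t => Z (t + s)) l (𝓝 η) := by
  have hc := hZ.continuous
  have hB0 : 0 ≤ B := (abs_nonneg _).trans (hB 0)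
  have hint : ∀ t, Integrable (fun y => Z (t + y)) h := fun t =>
    .of_bound (by fun_prop) B (.of_forall fun y => hB _)
  -- The excess over `η` vanishes in mean by dominated convergence. This is done along `atTop`,
  -- which is countably generated, because `l` is arbitrary.
  have hP : Tendsto (fun t => ∫ y, max (Z (t + y) - η) 0 ∂h) atTop (𝓝 (∫ _, 0 ∂h)) := by
    refine tendsto_integral_filter_of_dominated_convergence (fun _ => B + |η|)
      (.of_forall fun t => by fun_prop) (.of_forall fun t => .of_forall fun y => ?_)
      (integrable_const _) (.of_forall fun y => ?_)
    · rw [Real.norm_eq_abs, abs_of_nonneg (le_max_right _ _)]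
      exact max_le (by linarith [le_abs_self (Z (t + y)), hB (t + y), neg_abs_le η])
        (by positivity)
    · refine tendsto_order.2 ⟨fun a ha => .of_forall fun t => ha.trans_le (le_max_right _ _),
        fun a ha => ?_⟩
      filter_upwards [(tendsto_atTop_add_const_right atTop y tendsto_id).eventually
        (hη (a / 2) (by linarith))] with t ht
      simp only [id] at ht
      exact max_lt (by linarith) ha
  -- The renewal equation balances deficit against excess: when `Z t` is near `η`, the mean of `Z (t
  -- + y)` is too, so the mean deficit also vanishes.
  have hN : Tendsto (fun t => ∫ y, max (η - Z (t + y)) 0 ∂h) l (𝓝 0) := by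
    have h1 : ∀ t, ∫ y, max (η - Z (t + y)) 0 ∂h =
        ∫ y, max (Z (t + y) - η) 0 ∂h - Z t + e t + η := by
      intro t
      have hpos : Integrable (fun y => max (Z (t + y) - η) 0) h :=
        ((hint t).sub (integrable_const η)).pos_part
      have h2 : (fun y => max (η - Z (t + y)) 0) =
          fun y => max (Z (t + y) - η) 0 - (Z (t + y) - η) := by
        ext y
        rcases le_total (Z (t + y)) η with h | h
        · rw [max_eq_left (by linarith), max_eq_right (by linarith)]; ring
        · rw [max_eq_right (by linarith), max_eq_left (by linarith)]; ring
      have hsub : Integrable (fun y => Z (t + y) - η) h := (hint t).sub (integrable_const η)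
      rw [h2, integral_sub hpos hsub,
        integral_sub (hint t) (integrable_const η)]
      simp only [integral_const, probReal_univ, one_smul]
      linarith [heq t]
    simp_rw [h1]
    have := (((hP.mono_left hl).sub hlZ).add (he.mono_left hl)).add_const η
    simpa using this
  refine tendsto_order.2 ⟨fun a ha => ?_, fun a ha => ?_⟩
  -- A deficit `ε` at `t + s` would, by uniform continuity, persist as `ε / 2` on a ball around `s`
  -- of positive `h`-mass, contradicting `hN`.
  · set ε := η - a with hε
    obtain ⟨δ, hδ, hδZ⟩ := Metric.uniformContinuous_iff.1 hZ (ε / 2) (by linarith)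
    have hp : 0 < h.real (Metric.ball s δ) :=
      ENNReal.toReal_pos ((Measure.mem_support_iff_forall s).1 hs _ (Metric.ball_mem_nhds s hδ)).ne'
        (measure_ne_top _ _)
    filter_upwards [hN.eventually_lt_const (mul_pos hp (by linarith : 0 < ε / 2))] with t ht
    by_contra! hcon
    refine absurd ht (not_lt.2 ?_)
    have hi : Integrable (fun y => max (η - Z (t + y)) 0) h :=
      ((integrable_const η).sub (hint t)).pos_part
    calc h.real (Metric.ball s δ) * (ε / 2) = ∫ _ in Metric.ball s δ, ε / 2 ∂h := by simp
      _ ≤ ∫ y in Metric.ball s δ, max (η - Z (t + y)) 0 ∂h := by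
          refine setIntegral_mono_on (by simp) hi.integrableOn measurableSet_ball fun y hy => ?_
          have := hδZ (a := t + y) (b := t + s) (by simpa using hy)
          rw [Real.dist_eq, abs_lt] at this
          exact le_max_of_le_left (by linarith)
      _ ≤ _ := setIntegral_le_integral hi (.of_forall fun y => le_max_right _ _)
  · filter_upwards [hl ((tendsto_atTop_add_const_right atTop s tendsto_id).eventually
        (hη ((a - η) / 2) (by linarith)))] with t ht
    simp only [id] at ht
    linarith

lemma tendsto_add_of_mem_closure (hZ : UniformContinuous Z) (hB : ∀ t, |Z t| ≤ B)
    (heq : ∀ t, Z t = e t + ∫ y, Z (t + y) ∂h) (he : Tendsto e atTop (𝓝 0))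
    (hη : ∀ ε > 0, ∀ᶠ t in atTop, Z t ≤ η + ε) {l : Filter ℝ} (hl : l ≤ atTop)
    (hlZ : Tendsto Z l (𝓝 η)) {s : ℝ} (hs : s ∈ AddSubmonoid.closure h.support) :
    Tendsto (fun t => Z (t + s)) l (𝓝 η) := by
  induction hs using AddSubmonoid.closure_induction generalizing l with
  | mem x hx => exact tendsto_add_of_mem_support hZ hB heq he hη hl hlZ hx
  | zero => simpa using hlZ
  | add x y _ _ ihx ihy =>
    have hl' : map (fun t => t + x) l ≤ atTop :=
      (tendsto_atTop_add_const_right atTop x tendsto_id).mono_left hl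
    have := ihy hl' (tendsto_map'_iff.2 (ihx hl hlZ))
    rw [tendsto_map'_iff] at this
    refine this.congr fun t => ?_
    simp [add_assoc]

/-- A bounded uniformly continuous solution of the renewal equation is close to its upper limit
on arbitrarily long intervals arbitrarily far out. -/
lemma exists_seq_tendsto_sub (hnl : NonLattice h) (hneg : ∀ᵐ x ∂h, x ∈ Iic (0 : ℝ))
    (hZ : UniformContinuous Z) (hB : ∀ t, |Z t| ≤ B)
    (heq : ∀ t, Z t = e t + ∫ y, Z (t + y) ∂h) (he : Tendsto e atTop (𝓝 0)) :
    ∃ η : ℝ, (∀ ε > 0, ∀ᶠ t in atTop, Z t ≤ η + ε) ∧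
      ∃ τ : ℕ → ℝ, Tendsto τ atTop atTop ∧
        ∀ x, 0 ≤ x → Tendsto (fun k => Z (τ k - x)) atTop (𝓝 η) := by
  have hbdd : IsBoundedUnder (· ≤ ·) atTop Z :=
    isBoundedUnder_of ⟨B, fun t => (le_abs_self _).trans (hB t)⟩
  have hcob : IsCoboundedUnder (· ≤ ·) atTop Z :=
    (isBoundedUnder_of (r := (· ≥ ·)) ⟨-B, fun t => (abs_le.1 (hB t)).1⟩).isCoboundedUnder_le
  set η := limsup Z atTop with hηdef
  have hη : ∀ ε > 0, ∀ᶠ t in atTop, Z t ≤ η + ε := fun ε hε =>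
    (eventually_lt_of_limsup_lt (show limsup Z atTop < η + ε by linarith) hbdd).mono
      fun t ht => ht.le
  refine ⟨η, hη, ?_⟩
  -- The coarsest filter going to infinity along which `Z` tends to its upper limit; it is
  -- nontrivial because the limsup is approached frequently.
  set l : Filter ℝ := atTop ⊓ comap Z (𝓝 η) with hldef
  have hl : l ≤ atTop := inf_le_left
  have hlZ : Tendsto Z l (𝓝 η) := tendsto_comap.mono_left inf_le_right
  have hne : l.NeBot := by
    rw [hldef, inf_neBot_iff]
    intro s hs t ht
    obtain ⟨U, hU, hUt⟩ := ht
    obtain ⟨ε, hε, hεU⟩ := Metric.mem_nhds_iff.1 hU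
    have hf : ∃ᶠ t in atTop, η - ε < Z t :=
      frequently_lt_of_lt_limsup hcob (by rw [← hηdef]; linarith)
    obtain ⟨x, ⟨hx1, hx2⟩, hx3⟩ :=
      ((hf.and_eventually (hη (ε / 2) (by linarith))).and_eventually hs).exists
    refine ⟨x, hx3, hUt (hεU ?_)⟩
    rw [Metric.mem_ball, Real.dist_eq, abs_lt]
    constructor <;> linarith
  have key : ∀ n : ℕ, ∃ t : ℝ, (n : ℝ) ≤ t ∧ ∀ x ∈ Icc (0 : ℝ) n, |Z (t - x) - η| < 1 / (n + 1) := by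
    intro n
    have hε : (0 : ℝ) < 1 / (n + 1) := by positivity
    obtain ⟨δ, hδ, hδZ⟩ := Metric.uniformContinuous_iff.1 hZ _ (half_pos hε)
    obtain ⟨L, hL⟩ := hnl.exists_mem_closure_support hneg (half_pos hδ)
    -- Every `-x` with `x ≥ L` is close to a semigroup point; compactness and uniform continuity
    -- turn pointwise convergence into uniform closeness on `[L, L + n]`.
    have hK : ∀ᶠ t in l, ∀ x ∈ Icc L (L + n), |Z (t - x) - η| < 1 / (n + 1) := by
      refine isCompact_Icc.induction_on (p := fun K => ∀ᶠ t in l, ∀ x ∈ K,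
        |Z (t - x) - η| < 1 / (n + 1)) (by simp) (fun s t hst h => h.mono fun _ h x hx => h x (hst hx))
        (fun s t h1 h2 => ?_) fun x hx => ?_
      · filter_upwards [h1, h2] with a ha1 ha2 x hx
        exact hx.elim (ha1 x) (ha2 x)
      · obtain ⟨s, hs, hsx⟩ := hL x hx.1
        refine ⟨Metric.ball x (δ / 2), mem_nhdsWithin_of_mem_nhds
          (Metric.ball_mem_nhds x (half_pos hδ)), ?_⟩
        have h1 := tendsto_add_of_mem_closure hZ hB heq he hη hl hlZ hs
        filter_upwards [Metric.tendsto_nhds.1 h1 _ (half_pos hε)] with t ht y hy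
        have h2 := hδZ (a := t - y) (b := t + s) (by
          rw [Metric.mem_ball, Real.dist_eq, abs_lt] at hy
          rw [abs_lt] at hsx
          rw [Real.dist_eq, abs_lt]
          constructor <;> linarith [hy.1, hy.2, hsx.1, hsx.2])
        rw [Real.dist_eq, abs_lt] at h2 ht
        rw [abs_lt]
        constructor <;> linarith [h2.1, h2.2, ht.1, ht.2]
    obtain ⟨t, ht1, ht2⟩ := (hK.and (hl (eventually_ge_atTop (n + L)))).exists
    refine ⟨t - L, by linarith, fun x hx => ?_⟩
    have := ht1 (L + x) ⟨by linarith [hx.1], by linarith [hx.2]⟩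
    rwa [← sub_sub] at this
  choose τ hτ1 hτ2 using key
  refine ⟨τ, tendsto_atTop_mono hτ1 tendsto_natCast_atTop_atTop, fun x hx => ?_⟩
  rw [tendsto_iff_dist_tendsto_zero]
  refine squeeze_zero' (.of_forall fun k => dist_nonneg) ?_ tendsto_one_div_add_atTop_nhds_zero_nat
  obtain ⟨N, hN⟩ := exists_nat_ge x
  filter_upwards [eventually_ge_atTop N] with k hk
  exact (hτ2 k x ⟨hx, hN.trans (by exact_mod_cast hk)⟩).le

end renewalEquation

/-! ### Crossing identities and uniform local finiteness -/

section renewalMeasure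

open scoped ENNReal NNReal

variable {h U : Measure ℝ} [IsProbabilityMeasure h]

lemma measurable_measure_Iio_sub (h : Measure ℝ) (s : ℝ) : Measurable fun u => h (Iio (s - u)) :=
  Antitone.measurable fun u v huv => measure_mono (Iio_subset_Iio (by linarith))

lemma conv_apply_Ici [SFinite U] (hneg : ∀ᵐ x ∂h, x ∈ Iic (0 : ℝ)) (s : ℝ) :
    (h ∗ U) (Ici s) = ∫⁻ u in Ici s, h (Ici (s - u)) ∂U := by
  rw [Measure.conv_comm, conv_apply_eq_lintegral _ _ measurableSet_Ici,
    ← lintegral_indicator measurableSet_Ici]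
  refine lintegral_congr fun u => ?_
  have hpre : (fun y => u + y) ⁻¹' Ici s = Ici (s - u) := by
    ext y; simp only [mem_preimage, mem_Ici]; constructor <;> intro <;> linarith
  rw [hpre]
  by_cases hu : u ∈ Ici s
  · rw [indicator_of_mem hu]
  · rw [indicator_of_notMem hu]
    refine measure_mono_null (fun y hy => ?_) hneg
    simp only [mem_Ici, not_le] at hu hy
    exact not_le.2 (show 0 < y by linarith)

lemma measure_Ici_eq_add (s : ℝ) :
    U (Ici s) = ∫⁻ u in Ici s, h (Ici (s - u)) ∂U + ∫⁻ u in Ici s, h (Iio (s - u)) ∂U := by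
  rw [← lintegral_add_right _ (measurable_measure_Iio_sub h s)]
  have : ∀ u, h (Ici (s - u)) + h (Iio (s - u)) = 1 := fun u => by
    rw [← compl_Ici, measure_add_measure_compl measurableSet_Ici, measure_univ]
  simp [this]

/-- The renewal inequality on `[s, ∞)` splits the mass according to whether the next jump stays
above `s`; cancelling the finite part that stays leaves the crossings, bounded by the unit atom. -/
lemma lintegral_tail_le [SFinite U] (hneg : ∀ᵐ x ∂h, x ∈ Iic (0 : ℝ))
    (hU : U ≤ Measure.dirac 0 + h ∗ U) (s : ℝ) (hfin : U (Ici s) ≠ ∞) :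
    ∫⁻ u in Ici s, h (Iio (s - u)) ∂U ≤ 1 := by
  have h1 := hU (Ici s)
  rw [Measure.add_apply, conv_apply_Ici hneg] at h1
  rw [measure_Ici_eq_add (h := h)] at h1 hfin
  rw [add_comm] at h1
  exact ((ENNReal.add_le_add_iff_right (ENNReal.add_ne_top.1 hfin).1).1 h1).trans prob_le_one

/-- A descending renewal process started at `0` crosses a level `s ≤ 0` exactly once; the integral
sums over the position from which it jumps. -/
lemma lintegral_tail_eq [SFinite U] (hneg : ∀ᵐ x ∂h, x ∈ Iic (0 : ℝ))
    (hU : U = Measure.dirac 0 + h ∗ U) {s : ℝ} (hs : s ≤ 0) (hfin : U (Ici s) ≠ ∞) :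
    ∫⁻ u in Ici s, h (Iio (s - u)) ∂U = 1 := by
  have h1 := congrArg (fun ρ : Measure ℝ => ρ (Ici s)) hU
  simp only [Measure.add_apply] at h1
  rw [conv_apply_Ici hneg] at h1
  rw [measure_Ici_eq_add (h := h)] at h1 hfin
  rw [add_comm, ENNReal.add_left_inj (ENNReal.add_ne_top.1 hfin).1] at h1
  rw [h1, Measure.dirac_apply' _ measurableSet_Ici]
  simp [hs]

/-- The measure of intervals of a given length is bounded, uniformly in their position. -/
def UniformlyLocallyFinite (U : Measure ℝ) : Prop :=
  ∀ ℓ : ℝ, ∃ C : ℝ≥0, ∀ s : ℝ, U (Icc s (s + ℓ)) ≤ C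

lemma uniformlyLocallyFinite_of_le {δ : ℝ} (hδ : 0 < δ) {C : ℝ≥0}
    (hC : ∀ s, U (Icc s (s + δ)) ≤ C) : UniformlyLocallyFinite U := by
  intro ℓ
  obtain ⟨n, hn⟩ := exists_nat_ge (ℓ / δ)
  rw [div_le_iff₀ hδ] at hn
  refine ⟨(n + 1) * C, fun s => ?_⟩
  have key : ∀ n : ℕ, U (Icc s (s + n * δ)) ≤ (n + 1) * C := by
    intro n
    induction n with
    | zero =>
      rw [Nat.cast_zero, Nat.cast_zero, zero_mul, zero_add, one_mul]
      exact (measure_mono (Icc_subset_Icc le_rfl (by linarith))).trans (hC s)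
    | succ n ih =>
      have hsub : Icc s (s + (n + 1 : ℕ) * δ) ⊆
          Icc s (s + n * δ) ∪ Icc (s + n * δ) (s + n * δ + δ) := by
        intro x hx
        push_cast at hx
        rcases le_total x (s + n * δ) with h | h
        · exact Or.inl ⟨hx.1, h⟩
        · exact Or.inr ⟨h, by linarith [hx.2]⟩
      refine (measure_mono hsub).trans ((measure_union_le _ _).trans ?_)
      refine (add_le_add ih (hC _)).trans (le_of_eq ?_)
      push_cast; ring
  refine (measure_mono (Icc_subset_Icc le_rfl (by linarith))).trans ((key n).trans ?_)
  push_cast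
  exact le_rfl

lemma exists_measure_Iio_neg_ne_zero (h : Measure ℝ) (h0 : h (Iio 0) ≠ 0) :
    ∃ δ > 0, h (Iio (-δ)) ≠ 0 := by
  by_contra! hcon
  refine h0 (measure_mono_null (t := ⋃ n : ℕ, Iio (-(1 / ((n : ℝ) + 1)))) (fun x hx => ?_)
    (measure_iUnion_null fun n => hcon _ (by positivity)))
  obtain ⟨n, hn⟩ := exists_nat_one_div_lt (neg_pos.2 (mem_Iio.1 hx))
  exact mem_iUnion.2 ⟨n, by rw [mem_Iio]; linarith⟩

/-- From any point of a window of length `δ`, a jump below `-δ` crosses its left end. Crossings have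
total mass at most `1`, so the window has mass at most `1 / h (Iio (-δ))`, uniformly in the partial
sums. -/
lemma uniformlyLocallyFinite_occupation (μ : Measure ℝ) [IsProbabilityMeasure μ]
    [IsProbabilityMeasure (exitLaw μ (Iic 0))] (h0 : exitLaw μ (Iic 0) (Iio 0) ≠ 0) :
    UniformlyLocallyFinite (occupation μ) := by
  obtain ⟨δ, hδ, hp⟩ := exists_measure_Iio_neg_ne_zero _ h0
  set h := exitLaw μ (Iic 0) with hh
  set p := h (Iio (-δ)) with hpdef
  have hbound : ∀ n s, (∑ k ∈ Finset.range n, killedLaw μ (Iic 0) k) (Icc s (s + δ)) ≤ p⁻¹ := by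
    intro n s
    have h1 := lintegral_tail_le (ae_exitLaw_nonpos μ) (sum_killedLaw_le μ n) s (measure_ne_top _ _)
    set V := ∑ k ∈ Finset.range n, killedLaw μ (Iic 0) k
    have h2 : V (Icc s (s + δ)) * p ≤ 1 := by
      rw [mul_comm, ← setLIntegral_const]
      refine le_trans ?_ h1
      refine (setLIntegral_mono' measurableSet_Icc fun u hu => ?_).trans
        (lintegral_mono_set Icc_subset_Ici_self)
      exact measure_mono (Iio_subset_Iio (by linarith [hu.2]))
    rwa [← ENNReal.le_div_iff_mul_le (Or.inl hp) (Or.inl (measure_ne_top _ _)), one_div] at h2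
  refine uniformlyLocallyFinite_of_le hδ (C := (p⁻¹).toNNReal) fun s => ?_
  rw [ENNReal.coe_toNNReal (ENNReal.inv_ne_top.2 hp), occupation,
    Measure.sum_apply _ measurableSet_Icc, ENNReal.tsum_eq_iSup_nat]
  refine iSup_le fun n => ?_
  rw [← Measure.finsetSum_apply]
  exact hbound n s

lemma UniformlyLocallyFinite.isFiniteMeasureOnCompacts (hU : UniformlyLocallyFinite U) :
    IsFiniteMeasureOnCompacts U := by
  refine ⟨fun K hK => ?_⟩
  obtain ⟨R, hR⟩ := hK.isBounded.subset_closedBall 0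
  obtain ⟨C, hC⟩ := hU (2 * R)
  refine (measure_mono ?_).trans_lt ((hC (-R)).trans_lt ENNReal.coe_lt_top)
  rw [Real.closedBall_eq_Icc] at hR
  exact hR.trans (Icc_subset_Icc (by linarith) (by linarith))

end renewalMeasure

/-! ### The renewal theorem for continuous compactly supported functions -/

section keyRenewal

open scoped ENNReal NNReal

variable {h U : Measure ℝ} [IsProbabilityMeasure h] {z : ℝ → ℝ}

lemma exists_eq_zero_of_abs_gt (hc : HasCompactSupport z) :
    ∃ R, 0 < R ∧ ∀ t, R < |t| → z t = 0 := by
  obtain ⟨R, hR⟩ := hc.isCompact.isBounded.subset_closedBall 0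
  refine ⟨max R 1, by positivity, fun t ht => image_eq_zero_of_notMem_tsupport fun hmem => ?_⟩
  have := hR hmem
  rw [mem_closedBall_zero_iff, Real.norm_eq_abs] at this
  linarith [le_max_left R 1]

lemma abs_integral_add_le {w : ℝ → ℝ} {R ω t : ℝ} {C : ℝ≥0}
    (hC : ∀ s, U (Icc s (s + 2 * R)) ≤ C) (hw : ∀ u, |w u| ≤ ω)
    (hw0 : ∀ u, R < |t + u| → w u = 0) : |∫ u, w u ∂U| ≤ ω * C := by
  have hω : 0 ≤ ω := (abs_nonneg _).trans (hw 0)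
  rw [← setIntegral_eq_integral_of_forall_compl_eq_zero
    (s := Icc (-R - t) (-R - t + 2 * R)) fun u hu => hw0 u ?_]
  · refine (norm_setIntegral_le_of_norm_le_const (f := w) (C := ω)
      ((hC _).trans_lt ENNReal.coe_lt_top) fun u _ => hw u).trans ?_
    exact mul_le_mul_of_nonneg_left (ENNReal.toReal_le_coe_of_le_coe (hC _)) hω
  · by_contra! hcon
    rw [abs_le] at hcon
    exact hu ⟨by linarith [hcon.1], by linarith [hcon.2]⟩

lemma exists_bound_of_hasCompactSupport (hz : Continuous z) (hc : HasCompactSupport z) :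
    ∃ K, ∀ t, |z t| ≤ K := hc.exists_bound_of_continuous hz

lemma exists_abs_integral_add_le (hU : UniformlyLocallyFinite U) (hz : Continuous z)
    (hc : HasCompactSupport z) : ∃ B, ∀ t, |∫ u, z (t + u) ∂U| ≤ B := by
  obtain ⟨R, hR, hR0⟩ := exists_eq_zero_of_abs_gt hc
  obtain ⟨C, hC⟩ := hU (2 * R)
  obtain ⟨K, hK⟩ := exists_bound_of_hasCompactSupport hz hc
  exact ⟨K * C, fun t => abs_integral_add_le hC (fun u => hK _) fun u hu => hR0 _ hu⟩

lemma integrable_comp_add [IsFiniteMeasureOnCompacts U] (hz : Continuous z)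
    (hc : HasCompactSupport z) (t : ℝ) : Integrable (fun u => z (t + u)) U :=
  (hz.comp (continuous_const_add t)).integrable_of_hasCompactSupport
    (hc.comp_homeomorph (Homeomorph.addLeft t))

lemma uniformContinuous_integral_add (hU : UniformlyLocallyFinite U) (hz : Continuous z)
    (hc : HasCompactSupport z) : UniformContinuous fun t => ∫ u, z (t + u) ∂U := by
  have := hU.isFiniteMeasureOnCompacts
  obtain ⟨R, hR, hR0⟩ := exists_eq_zero_of_abs_gt hc
  -- The margin `1` lets a single window contain the supports of both translates once `|s - t| < 1`.
  obtain ⟨C, hC⟩ := hU (2 * (R + 1))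
  refine Metric.uniformContinuous_iff.2 fun ε hε => ?_
  obtain ⟨δ, hδ, hz'⟩ := Metric.uniformContinuous_iff.1 (hc.uniformContinuous_of_continuous hz)
    (ε / (C + 1)) (by positivity)
  refine ⟨min δ 1, by positivity, fun {s t} hst => ?_⟩
  rw [Real.dist_eq, ← integral_sub (integrable_comp_add hz hc s) (integrable_comp_add hz hc t)]
  rw [Real.dist_eq, lt_min_iff] at hst
  refine (abs_integral_add_le (t := t) (ω := ε / (C + 1)) hC (fun u => ?_)
    fun u hu => ?_).trans_lt ?_
  · have := hz' (a := s + u) (b := t + u) (by rw [Real.dist_eq]; simpa using hst.1)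
    exact this.le
  · rw [hR0, hR0, sub_zero]
    · linarith
    · have : |t + u| ≤ |s + u| + |s - t| := by
        rw [show t + u = (s + u) - (s - t) by ring]; exact abs_sub _ _
      linarith
  · rw [div_mul_eq_mul_div, div_lt_iff₀ (by positivity)]
    nlinarith [C.coe_nonneg]

lemma integral_add_renewal_eq [SFinite U] (hU : UniformlyLocallyFinite U)
    (hUeq : U = Measure.dirac 0 + h ∗ U) (hz : Continuous z) (hc : HasCompactSupport z) (t : ℝ) :
    ∫ u, z (t + u) ∂U = z t + ∫ y, ∫ u, z (t + y + u) ∂U ∂h := by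
  have := hU.isFiniteMeasureOnCompacts
  have hi : Integrable (fun u => z (t + u)) (h ∗ U) := by
    refine (integrable_comp_add (U := U) hz hc t).mono_measure ?_
    conv_rhs => rw [hUeq]
    exact Measure.le_add_left le_rfl
  conv_lhs => rw [hUeq]
  rw [integral_add_measure (integrable_dirac (by simp)) hi, integral_dirac, integral_conv hi]
  simp [add_assoc]

/-- By Tonelli and the substitution `s = t - y + u`, the inner integral becomes the crossing
probability of level `s - t`, which is `1` for `s ≤ t`; beyond `t` the function `f` vanishes. -/
lemma lintegral_tail_mul (hU : UniformlyLocallyFinite U) [SFinite U]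
    (hUneg : ∀ᵐ x ∂U, x ∈ Iic (0 : ℝ)) (hneg : ∀ᵐ x ∂h, x ∈ Iic (0 : ℝ))
    (hUeq : U = Measure.dirac 0 + h ∗ U) {f : ℝ → ℝ≥0∞} (hf : Measurable f) {t : ℝ}
    (ht : ∀ s, t < s → f s = 0) :
    ∫⁻ y in Ioi 0, (∫⁻ u, f (t - y + u) ∂U) * h (Iio (-y)) = ∫⁻ s, f s := by
  have hfin : ∀ s, U (Ici s) ≠ ∞ := by
    intro s
    obtain ⟨C, hC⟩ := hU (-s)
    refine ne_top_of_le_ne_top ENNReal.coe_ne_top ((measure_mono_ae ?_).trans (hC s))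
    filter_upwards [hUneg] with x hx hxs
    exact ⟨hxs, by simpa using hx⟩
  have hG : Measurable fun y => h (Iio (-y)) := by simpa using measurable_measure_Iio_sub h 0
  calc ∫⁻ y in Ioi 0, (∫⁻ u, f (t - y + u) ∂U) * h (Iio (-y))
      = ∫⁻ y in Ici 0, (∫⁻ u, f (t - y + u) ∂U) * h (Iio (-y)) :=
        setLIntegral_congr Ioi_ae_eq_Ici
    _ = ∫⁻ y, ∫⁻ u, f (t - y + u) * (Ici 0).indicator (fun y => h (Iio (-y))) y ∂U := by
        rw [← lintegral_indicator measurableSet_Ici]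
        refine lintegral_congr fun y => ?_
        rw [lintegral_mul_const _ (by fun_prop)]
        by_cases hy : y ∈ Ici (0 : ℝ) <;> simp [hy]
    _ = ∫⁻ u, (∫⁻ y, f (t - y + u) * (Ici 0).indicator (fun y => h (Iio (-y))) y) ∂U := by
        refine lintegral_lintegral_swap (Measurable.aemeasurable ?_)
        exact (hf.comp (by fun_prop)).mul ((hG.indicator measurableSet_Ici).comp measurable_fst)
    _ = ∫⁻ u, (∫⁻ s, f s * (Ici (s - t)).indicator (fun u => h (Iio (s - t - u))) u) ∂U := by
        refine lintegral_congr fun u => ?_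
        rw [← lintegral_sub_left_eq_self _ (t + u)]
        refine lintegral_congr fun s => ?_
        have h1 : t - (t + u - s) + u = s := by ring
        have h2 : -(t + u - s) = s - t - u := by ring
        have h3 : t + u - s ∈ Ici (0 : ℝ) ↔ u ∈ Ici (s - t) := by
          simp only [mem_Ici]; constructor <;> intro <;> linarith
        rw [h1]
        congr 1
        by_cases hu : u ∈ Ici (s - t)
        · rw [indicator_of_mem hu, indicator_of_mem (h3.2 hu), h2]
        · rw [indicator_of_notMem hu, indicator_of_notMem (mt h3.1 hu)]
    _ = ∫⁻ s, ∫⁻ u, f s * (Ici (s - t)).indicator (fun u => h (Iio (s - t - u))) u ∂U := by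
        refine lintegral_lintegral_swap (Measurable.aemeasurable ?_)
        refine (hf.comp measurable_snd).mul ?_
        have : (Function.uncurry fun u s => (Ici (s - t)).indicator (fun u => h (Iio (s - t - u))) u)
            = {p : ℝ × ℝ | p.2 - t ≤ p.1}.indicator fun p => h (Iio (-(p.1 + t - p.2))) := by
          ext ⟨u, s⟩
          simp only [Function.uncurry, indicator, mem_Ici, mem_ofPred_eq]
          rw [show -(u + t - s) = s - t - u by ring]
        change Measurable (Function.uncurry fun u s => (Ici (s - t)).indicator (fun u => h (Iio (s - t - u))) u)
        rw [this]
        exact (hG.comp (by fun_prop : Measurable fun p : ℝ × ℝ => p.1 + t - p.2)).indicator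
          (measurableSet_le (by fun_prop) (by fun_prop))
    _ = ∫⁻ s, f s := by
        refine lintegral_congr fun s => ?_
        rw [lintegral_const_mul _ ((measurable_measure_Iio_sub h (s - t)).indicator
          measurableSet_Ici), lintegral_indicator measurableSet_Ici]
        rcases le_or_gt s t with hs | hs
        · rw [lintegral_tail_eq hneg hUeq (by linarith) (hfin _), mul_one]
        · rw [ht s hs, zero_mul]

/-- The renewal theorem for a renewal measure on `(-∞, 0]`. -/
theorem tendsto_integral_add (hnl : NonLattice h) (hneg : ∀ᵐ x ∂h, x ∈ Iic (0 : ℝ))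
    (hint : Integrable id h) (hm : ∫ x, x ∂h < 0) [SFinite U] (hU : UniformlyLocallyFinite U)
    (hUneg : ∀ᵐ x ∂U, x ∈ Iic (0 : ℝ)) (hUeq : U = Measure.dirac 0 + h ∗ U)
    (hz : Continuous z) (hc : HasCompactSupport z) (hz0 : ∀ t, 0 ≤ z t) :
    Tendsto (fun t => ∫ u, z (t + u) ∂U) atTop (𝓝 ((∫ s, z s) / -∫ x, x ∂h)) := by
  have := hU.isFiniteMeasureOnCompacts
  set m := -∫ x, x ∂h with hmdef
  have hm0 : 0 < m := by linarith
  set Z := fun t => ∫ u, z (t + u) ∂U with hZdef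
  obtain ⟨B, hB⟩ := exists_abs_integral_add_le hU hz hc
  obtain ⟨R, hR, hR0⟩ := exists_eq_zero_of_abs_gt hc
  have hZu : UniformContinuous Z := uniformContinuous_integral_add hU hz hc
  have hZ0 : ∀ t, 0 ≤ Z t := fun t => integral_nonneg fun u => hz0 _
  have heq : ∀ t, Z t = z t + ∫ y, Z (t + y) ∂h := integral_add_renewal_eq hU hUeq hz hc
  have hzt : Tendsto z atTop (𝓝 0) := tendsto_const_nhds.congr' (by
    filter_upwards [eventually_gt_atTop R] with t ht
    rw [hR0 t (ht.trans_le (le_abs_self t))])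
  have hG : Measurable fun y => h (Iio (-y)) := by simpa using measurable_measure_Iio_sub h 0
  have hset : ∀ y : ℝ, {a : ℝ | y < -a} = Iio (-y) := fun y => by
    ext a; simp only [mem_ofPred_eq, mem_Iio]; constructor <;> intro <;> linarith
  have hnn : 0 ≤ᵐ[h] fun x => -x := hneg.mono fun x hx => by simpa using hx
  have hmG : ∫ y in Ioi (0 : ℝ), h.real (Iio (-y)) = m := by
    have := hint.neg.integral_eq_integral_meas_lt hnn
    simp only [Pi.neg_apply, id, hset] at this
    rw [← this, integral_neg]
  have hGi : IntegrableOn (fun y => h.real (Iio (-y))) (Ioi 0) := by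
    refine ⟨hG.ennreal_toReal.aestronglyMeasurable, ?_⟩
    rw [hasFiniteIntegral_iff_ofReal (.of_forall fun y => measureReal_nonneg)]
    have := lintegral_eq_lintegral_meas_lt h hnn (by fun_prop)
    simp only [hset] at this
    refine lt_of_eq_of_lt (lintegral_congr fun y => ofReal_measureReal) ?_
    rw [← this]
    exact hint.neg.lintegral_lt_top
  have hmeas : ∀ t, Measurable fun y => Z (t - y) * h.real (Iio (-y)) := fun t =>
    (hZu.continuous.measurable.comp (measurable_const.sub measurable_id)).mul hG.ennreal_toReal
  have hmass : ∀ t, R < t → ∫ y in Ioi 0, Z (t - y) * h.real (Iio (-y)) = ∫ s, z s := by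
    intro t ht
    have h1 := lintegral_tail_mul hU hUneg hneg hUeq (f := fun s => ENNReal.ofReal (z s))
      (by fun_prop) (t := t) fun s hs => by
        rw [hR0 s ((ht.trans hs).trans_le (le_abs_self s)), ENNReal.ofReal_zero]
    rw [integral_eq_lintegral_of_nonneg_ae (.of_forall hz0) hz.aestronglyMeasurable, ← h1,
      integral_eq_lintegral_of_nonneg_ae
        (.of_forall fun y => mul_nonneg (hZ0 _) measureReal_nonneg)
        (hmeas t).aestronglyMeasurable]
    congr 1
    refine lintegral_congr fun y => ?_
    rw [ENNReal.ofReal_mul (hZ0 _), ofReal_measureReal]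
    congr 1
    exact ofReal_integral_eq_lintegral_ofReal (integrable_comp_add hz hc _)
      (.of_forall fun u => hz0 _)
  -- Passing to the limit in the mass identity: finite mean makes `h (Iio (-y))` an integrable
  -- dominating tail, with integral `m`.
  have hlim : ∀ (τ : ℕ → ℝ) (η : ℝ), Tendsto τ atTop atTop →
      (∀ x, 0 ≤ x → Tendsto (fun k => Z (τ k - x)) atTop (𝓝 η)) → η * m = ∫ s, z s := by
    intro τ η hτ hη
    have h1 : Tendsto (fun k => ∫ y in Ioi 0, Z (τ k - y) * h.real (Iio (-y))) atTop
        (𝓝 (∫ y in Ioi 0, η * h.real (Iio (-y)))) := by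
      refine tendsto_integral_filter_of_dominated_convergence
        (fun y => B * h.real (Iio (-y))) (.of_forall fun k => ?_)
        (.of_forall fun k => .of_forall fun y => ?_) (hGi.const_mul B) ?_
      · exact (hmeas _).aestronglyMeasurable
      · rw [norm_mul, Real.norm_of_nonneg (measureReal_nonneg (μ := h))]
        exact mul_le_mul_of_nonneg_right (hB _) measureReal_nonneg
      · filter_upwards [ae_restrict_mem measurableSet_Ioi] with y hy
        exact (hη y (le_of_lt hy)).mul_const _
    rw [integral_const_mul, hmG] at h1
    refine tendsto_nhds_unique h1 (tendsto_const_nhds.congr' ?_)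
    filter_upwards [hτ.eventually (eventually_gt_atTop R)] with k hk
    exact (hmass _ hk).symm
  obtain ⟨η, hη, τ, hτ, hτη⟩ := exists_seq_tendsto_sub hnl hneg hZu hB heq hzt
  -- Applied to `-Z`, which solves the equation with `-z`, this controls the lower limit.
  obtain ⟨η', hη', τ', hτ', hτη'⟩ := exists_seq_tendsto_sub (Z := fun t => -Z t)
    (e := fun t => -z t) (B := B) hnl hneg hZu.neg (fun t => by rw [abs_neg]; exact hB t)
    (fun t => by rw [integral_neg, heq t]; ring) (by simpa using hzt.neg)
  have e1 := hlim τ η hτ hτη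
  have e2 := hlim τ' (-η') hτ' fun x hx => by simpa using (hτη' x hx).neg
  have h1 : η = (∫ s, z s) / m := by rw [eq_div_iff hm0.ne', e1]
  have h2 : -η' = (∫ s, z s) / m := by rw [eq_div_iff hm0.ne', e2]
  rw [← h1]
  refine Metric.tendsto_nhds.2 fun ε hε => ?_
  filter_upwards [hη (ε / 2) (half_pos hε), hη' (ε / 2) (half_pos hε)] with t ht1 ht2
  rw [Real.dist_eq, abs_lt]
  constructor <;> linarith

end keyRenewal

/-! ### From vague convergence to directly Riemann integrable functions -/

section directRiemann

open scoped ENNReal NNReal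

/-- A continuous compactly supported function between the indicators of `[α, β]` and
`(α - ε, β + ε)`. -/
lemma exists_trapezoid (α β : ℝ) {ε : ℝ} (hε : 0 < ε) :
    ∃ z : ℝ → ℝ, Continuous z ∧ HasCompactSupport z ∧ (∀ t, 0 ≤ z t) ∧
      (∀ t, z t ≤ (Ioo (α - ε) (β + ε)).indicator 1 t) ∧
      ∀ t, (Icc α β).indicator 1 t ≤ z t := by
  have hout : ∀ t, t ∉ Ioo (α - ε) (β + ε) → max 0 (min 1 (1 - max (α - t) (t - β) / ε)) = 0 := by
    intro t ht
    have : ε ≤ max (α - t) (t - β) := by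
      by_contra! hcon
      obtain ⟨h1, h2⟩ := max_lt_iff.1 hcon
      exact ht ⟨by linarith, by linarith⟩
    have h1 : 1 ≤ max (α - t) (t - β) / ε := (one_le_div hε).2 this
    exact max_eq_left ((min_le_right _ _).trans (by linarith))
  refine ⟨fun t => max 0 (min 1 (1 - max (α - t) (t - β) / ε)), by fun_prop, ?_,
    fun t => le_max_left _ _, fun t => ?_, fun t => ?_⟩
  · exact .intro (isCompact_Icc (a := α - ε) (b := β + ε))
      fun t ht => hout t fun h => ht (Ioo_subset_Icc_self h)
  · by_cases ht : t ∈ Ioo (α - ε) (β + ε)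
    · rw [indicator_of_mem ht]
      exact max_le zero_le_one (min_le_left _ _)
    · rw [indicator_of_notMem ht]
      exact (hout t ht).le
  · by_cases ht : t ∈ Icc α β
    · rw [indicator_of_mem ht]
      have : max (α - t) (t - β) / ε ≤ 0 :=
        div_nonpos_of_nonpos_of_nonneg (max_le (by linarith [ht.1]) (by linarith [ht.2])) hε.le
      exact le_max_of_le_right (le_min le_rfl (by simp; linarith))
    · rw [indicator_of_notMem ht]
      exact le_max_left _ _

/-- Open cells keep the first one inside `(0, ∞)`: a possible atom of `ρ` at `0` must not be counted
in the lower bound. -/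
lemma tsum_iInf_mul_le (ρ : Measure ℝ) (g : ℝ → ℝ) {h : ℝ} (hh : 0 < h) :
    ∑' n : ℕ, (⨅ y ∈ Ico (n * h) ((n + 1) * h), ENNReal.ofReal (g y)) *
      ρ (Ioo (n * h) ((n + 1) * h)) ≤ ∫⁻ y in Ioi 0, ENNReal.ofReal (g y) ∂ρ := by
  have hdisj : Pairwise (Function.onFun Disjoint fun n : ℕ => Ioo (n * h) ((n + 1) * h)) := by
    intro i j hij
    refine disjoint_left.2 fun x hi hj => ?_
    wlog hlt : i < j generalizing i j
    · exact this hij.symm hj hi (by omega)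
    have : ((i : ℝ) + 1) * h ≤ j * h :=
      mul_le_mul_of_nonneg_right (by exact_mod_cast hlt) hh.le
    linarith [hi.2, hj.1]
  calc _ ≤ ∑' n : ℕ, ∫⁻ y in Ioo (n * h) ((n + 1) * h), ENNReal.ofReal (g y) ∂ρ := by
        refine ENNReal.tsum_le_tsum fun n => ?_
        rw [← setLIntegral_const]
        exact setLIntegral_mono' measurableSet_Ioo
          fun y hy => iInf₂_le y (Ioo_subset_Ico_self hy)
    _ = ∫⁻ y in ⋃ n : ℕ, Ioo (n * h) ((n + 1) * h), ENNReal.ofReal (g y) ∂ρ :=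
        (lintegral_iUnion (fun n => measurableSet_Ioo) hdisj _).symm
    _ ≤ _ := by
        refine lintegral_mono_set (iUnion_subset fun n x hx => ?_)
        exact lt_of_le_of_lt (by positivity) hx.1

lemma le_tsum_iSup_mul (ρ : Measure ℝ) (g : ℝ → ℝ) {h : ℝ} (hh : 0 < h) :
    ∫⁻ y in Ioi 0, ENNReal.ofReal (g y) ∂ρ ≤
      ∑' n : ℕ, (⨆ y ∈ Ico (n * h) ((n + 1) * h), ENNReal.ofReal (g y)) *
        ρ (Ico (n * h) ((n + 1) * h)) := by
  have hcover : Ioi (0 : ℝ) ⊆ ⋃ n : ℕ, Ico (n * h) ((n + 1) * h) := by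
    intro x hx
    have hx0 : 0 ≤ x / h := div_nonneg (le_of_lt hx) hh.le
    refine mem_iUnion.2 ⟨⌊x / h⌋₊, ?_, ?_⟩
    · exact (le_div_iff₀ hh).1 (Nat.floor_le hx0)
    · exact (div_lt_iff₀ hh).1 (Nat.lt_floor_add_one _)
  calc _ ≤ ∫⁻ y in ⋃ n : ℕ, Ico (n * h) ((n + 1) * h), ENNReal.ofReal (g y) ∂ρ :=
        lintegral_mono_set hcover
    _ ≤ ∑' n : ℕ, ∫⁻ y in Ico (n * h) ((n + 1) * h), ENNReal.ofReal (g y) ∂ρ :=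
        lintegral_iUnion_le _ _
    _ ≤ _ := by
        refine ENNReal.tsum_le_tsum fun n => ?_
        rw [← setLIntegral_const]
        exact setLIntegral_mono' measurableSet_Ico
          fun y hy => le_iSup₂ (f := fun y _ => ENNReal.ofReal (g y)) y hy

lemma lowerSum_le_lintegral (g : ℝ → ℝ) {h : ℝ} (hh : 0 < h) :
    lowerSum g h ≤ ∫⁻ y in Ioi 0, ENNReal.ofReal (g y) := by
  refine le_trans (le_of_eq (tsum_congr fun n => ?_)) (tsum_iInf_mul_le volume g hh)
  rw [Real.volume_Ioo, mul_comm]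
  congr 2; ring

lemma lintegral_le_upperSum (g : ℝ → ℝ) {h : ℝ} (hh : 0 < h) :
    ∫⁻ y in Ioi 0, ENNReal.ofReal (g y) ≤ upperSum g h := by
  refine (le_tsum_iSup_mul volume g hh).trans (le_of_eq (tsum_congr fun n => ?_))
  rw [Real.volume_Ico, mul_comm]
  congr 2; ring

variable {ν : ℝ → Measure ℝ} [∀ x, IsFiniteMeasure (ν x)] {c : ℝ}

/-- Vague convergence to a multiple of the Lebesgue measure implies convergence on intervals. -/
lemma tendsto_measureReal_interval (hc : 0 ≤ c)
    (hν : ∀ z : ℝ → ℝ, Continuous z → HasCompactSupport z → (∀ t, 0 ≤ z t) →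
      Tendsto (fun x => ∫ y, z y ∂ν x) atTop (𝓝 (c * ∫ t, z t)))
    {a b : ℝ} (hab : a < b) {S : Set ℝ} (hS : MeasurableSet S) (h1 : Ioo a b ⊆ S)
    (h2 : S ⊆ Icc a b) : Tendsto (fun x => (ν x).real S) atTop (𝓝 (c * (b - a))) := by
  have hlim : Tendsto (fun ε : ℝ => c * (b - a - 2 * ε)) (𝓝[>] 0) (𝓝 (c * (b - a))) := by
    refine tendsto_nhdsWithin_of_tendsto_nhds ?_
    have : Continuous fun ε : ℝ => c * (b - a - 2 * ε) := by fun_prop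
    simpa using this.tendsto 0
  have hlim' : Tendsto (fun ε : ℝ => c * (b - a + 2 * ε)) (𝓝[>] 0) (𝓝 (c * (b - a))) := by
    refine tendsto_nhdsWithin_of_tendsto_nhds ?_
    have : Continuous fun ε : ℝ => c * (b - a + 2 * ε) := by fun_prop
    simpa using this.tendsto 0
  refine tendsto_order.2 ⟨fun r hr => ?_, fun r hr => ?_⟩
  · obtain ⟨ε, ⟨hεr, hε2⟩, hε⟩ := ((hlim.eventually_const_lt hr).and
      (nhdsWithin_le_nhds (gt_mem_nhds (show 0 < (b - a) / 2 by linarith)))).and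
      self_mem_nhdsWithin |>.exists
    have hε0 : 0 < ε := hε
    obtain ⟨z, hz, hzc, hz0, hz1, hz2⟩ := exists_trapezoid (a + ε) (b - ε) hε0
    have hint : b - a - 2 * ε ≤ ∫ t, z t := by
      calc b - a - 2 * ε = ∫ t, (Icc (a + ε) (b - ε)).indicator (1 : ℝ → ℝ) t := by
            rw [integral_indicator_one measurableSet_Icc, Real.volume_real_Icc_of_le (by linarith)]
            ring
        _ ≤ _ := integral_mono ((integrable_indicator_iff measurableSet_Icc).2
            (by simp [integrableOn_const_iff, Pi.one_def])) (hz.integrable_of_hasCompactSupport hzc) hz2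
    have hr' : r < c * ∫ t, z t := hεr.trans_le (mul_le_mul_of_nonneg_left hint hc)
    filter_upwards [(hν z hz hzc hz0).eventually_const_lt hr'] with x hx
    refine hx.trans_le ?_
    rw [← integral_indicator_one hS]
    refine integral_mono (hz.integrable_of_hasCompactSupport hzc)
      ((integrable_indicator_iff hS).2 (integrable_const _)) fun t => (hz1 t).trans ?_
    refine indicator_le_indicator_of_subset ?_ (fun _ => zero_le_one) t
    rw [add_sub_cancel_right, sub_add_cancel]
    exact h1
  · obtain ⟨ε, hεr, hε⟩ := ((hlim'.eventually_lt_const hr).and self_mem_nhdsWithin).exists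
    have hε0 : 0 < ε := hε
    obtain ⟨z, hz, hzc, hz0, hz1, hz2⟩ := exists_trapezoid a b hε0
    have hint : ∫ t, z t ≤ b - a + 2 * ε := by
      calc ∫ t, z t ≤ ∫ t, (Ioo (a - ε) (b + ε)).indicator (1 : ℝ → ℝ) t :=
            integral_mono (hz.integrable_of_hasCompactSupport hzc)
              ((integrable_indicator_iff measurableSet_Ioo).2
                (by simp [integrableOn_const_iff, Pi.one_def])) hz1
        _ = b - a + 2 * ε := by
            rw [integral_indicator_one measurableSet_Ioo, Real.volume_real_Ioo_of_le (by linarith)]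
            ring
    have hr' : c * ∫ t, z t < r := (mul_le_mul_of_nonneg_left hint hc).trans_lt hεr
    filter_upwards [(hν z hz hzc hz0).eventually_lt_const hr'] with x hx
    refine lt_of_le_of_lt ?_ hx
    rw [← integral_indicator_one hS]
    refine integral_mono ((integrable_indicator_iff hS).2 (integrable_const _))
      (hz.integrable_of_hasCompactSupport hzc) fun t => le_trans ?_ (hz2 t)
    exact indicator_le_indicator_of_subset h2 (fun _ => zero_le_one) t

/-- Dominated convergence for series: each cell mass converges to `c * h`, and the bound uniform
over cells makes a multiple of `a` a summable majorant. The sandwich on `S n` serves both the open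
cells of lower sums and the half-open cells of upper sums. -/
lemma tendsto_tsum_mul_measure (hc : 0 ≤ c)
    (hν : ∀ z : ℝ → ℝ, Continuous z → HasCompactSupport z → (∀ t, 0 ≤ z t) →
      Tendsto (fun x => ∫ y, z y ∂ν x) atTop (𝓝 (c * ∫ t, z t)))
    (hbound : ∀ ℓ : ℝ, ∃ C : ℝ≥0, ∀ᶠ x in atTop, ∀ a, 0 ≤ a → ν x (Icc a (a + ℓ)) ≤ C)
    {h : ℝ} (hh : 0 < h) {a : ℕ → ℝ≥0∞} (ha : ∑' n, ENNReal.ofReal h * a n < ∞)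
    {S : ℕ → Set ℝ} (hS : ∀ n, MeasurableSet (S n))
    (h1 : ∀ n : ℕ, Ioo (n * h) ((n + 1) * h) ⊆ S n)
    (h2 : ∀ n : ℕ, S n ⊆ Icc (n * h) ((n + 1) * h)) :
    Tendsto (fun x => ∑' n, a n * ν x (S n)) atTop
      (𝓝 (ENNReal.ofReal c * ∑' n, ENNReal.ofReal h * a n)) := by
  have hh' : ENNReal.ofReal h ≠ 0 := by simpa using hh
  have hsum : ∑' n, a n ≠ ∞ := by
    rw [ENNReal.tsum_mul_left] at ha
    intro htop
    rw [htop, ENNReal.mul_top hh'] at ha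
    exact ha.ne rfl
  have hsumm : Summable fun n => (a n).toReal := ENNReal.summable_toReal hsum
  have hfin : ∀ n, a n ≠ ∞ := ENNReal.ne_top_of_tsum_ne_top hsum
  obtain ⟨C, hC⟩ := hbound h
  have hCS : ∀ᶠ x in atTop, ∀ n, (ν x).real (S n) ≤ C := by
    filter_upwards [hC] with x hx n
    refine ENNReal.toReal_le_coe_of_le_coe ((measure_mono (h2 n)).trans ?_)
    rw [add_mul, one_mul]
    exact hx _ (by positivity)
  have key : Tendsto (fun x => ∑' n, (a n).toReal * (ν x).real (S n)) atTop
      (𝓝 (∑' n, (a n).toReal * (c * h))) := by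
    refine tendsto_tsum_of_dominated_convergence (bound := fun n => (a n).toReal * C)
      (hsumm.mul_right _) (fun n => ?_) ?_
    · have := tendsto_measureReal_interval hc hν (a := n * h) (b := (n + 1) * h) (by linarith)
        (hS n) (h1 n) (h2 n)
      rw [show ((n : ℝ) + 1) * h - n * h = h by ring] at this
      exact this.const_mul _
    · filter_upwards [hCS] with x hx n
      rw [Real.norm_of_nonneg (by positivity)]
      exact mul_le_mul_of_nonneg_left (hx n) ENNReal.toReal_nonneg
  have hlim := ENNReal.tendsto_ofReal key
  have e1 : ENNReal.ofReal (∑' n, (a n).toReal * (c * h)) =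
      ENNReal.ofReal c * ∑' n, ENNReal.ofReal h * a n := by
    rw [ENNReal.ofReal_tsum_of_nonneg (fun n => by positivity) (hsumm.mul_right _),
      ← ENNReal.tsum_mul_left]
    refine tsum_congr fun n => ?_
    rw [ENNReal.ofReal_mul ENNReal.toReal_nonneg, ENNReal.ofReal_toReal (hfin n),
      ENNReal.ofReal_mul hc]
    ring
  rw [e1] at hlim
  refine hlim.congr' ?_
  filter_upwards [hCS] with x hx
  rw [ENNReal.ofReal_tsum_of_nonneg (fun n => by positivity)
    ((hsumm.mul_right (C : ℝ)).of_nonneg_of_le (fun n => by positivity)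
      fun n => mul_le_mul_of_nonneg_left (hx n) ENNReal.toReal_nonneg)]
  refine tsum_congr fun n => ?_
  rw [ENNReal.ofReal_mul ENNReal.toReal_nonneg, ENNReal.ofReal_toReal (hfin n), ofReal_measureReal]

/-- Vague convergence to a multiple of the Lebesgue measure, with uniform bounds on intervals,
implies convergence of the integrals of directly Riemann integrable functions. -/
lemma tendsto_integral_of_directlyRiemannIntegrable (hc : 0 ≤ c)
    (hν : ∀ z : ℝ → ℝ, Continuous z → HasCompactSupport z → (∀ t, 0 ≤ z t) →
      Tendsto (fun x => ∫ y, z y ∂ν x) atTop (𝓝 (c * ∫ t, z t)))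
    (hbound : ∀ ℓ : ℝ, ∃ C : ℝ≥0, ∀ᶠ x in atTop, ∀ a, 0 ≤ a → ν x (Icc a (a + ℓ)) ≤ C)
    {g : ℝ → ℝ} (hg : Measurable g) (hgR : DirectlyRiemannIntegrable g) :
    Tendsto (fun x => ∫ y in Ioi 0, g y ∂ν x) atTop (𝓝 (c * ∫ y in Ioi 0, g y)) := by
  obtain ⟨hg0, hup, hdiff⟩ := hgR
  set G := ∫⁻ y in Ioi 0, ENNReal.ofReal (g y) with hGdef
  have hnn : ∀ ρ : Measure ℝ, 0 ≤ᵐ[ρ.restrict (Ioi 0)] g := fun ρ =>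
    (ae_restrict_mem measurableSet_Ioi).mono fun y hy => hg0 y (le_of_lt hy)
  have hGfin : G ≠ ∞ := ((lintegral_le_upperSum g one_pos).trans_lt (hup 1 one_pos)).ne
  have hle : ∀ h, 0 < h → upperSum g h ≤ lowerSum g h + (upperSum g h - lowerSum g h) :=
    fun h _ => le_add_tsub
  have main : Tendsto (fun x => ∫⁻ y in Ioi 0, ENNReal.ofReal (g y) ∂ν x) atTop
      (𝓝 (ENNReal.ofReal c * G)) := by
    refine tendsto_order.2 ⟨fun r hr => ?_, fun r hr => ?_⟩
    · have hlim : Tendsto (fun h => ENNReal.ofReal c * (G - (upperSum g h - lowerSum g h)))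
          (𝓝[>] 0) (𝓝 (ENNReal.ofReal c * (G - 0))) :=
        ENNReal.Tendsto.const_mul (ENNReal.Tendsto.sub tendsto_const_nhds hdiff (Or.inl hGfin))
          (Or.inr ENNReal.ofReal_ne_top)
      rw [tsub_zero] at hlim
      obtain ⟨h, hhr, hh⟩ := ((hlim.eventually_const_lt hr).and self_mem_nhdsWithin).exists
      have hlow : G - (upperSum g h - lowerSum g h) ≤ lowerSum g h :=
        tsub_le_iff_right.2 ((lintegral_le_upperSum g hh).trans (hle h hh))
      have hlt : r < ENNReal.ofReal c * lowerSum g h := hhr.trans_le (by gcongr)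
      have hfin : lowerSum g h < ∞ := ((lowerSum_le_lintegral g hh).trans_lt hGfin.lt_top)
      have := tendsto_tsum_mul_measure hc hν hbound hh hfin
        (S := fun n => Ioo (n * h) ((n + 1) * h)) (fun n => measurableSet_Ioo)
        (fun n => subset_rfl) fun n => Ioo_subset_Icc_self
      filter_upwards [this.eventually_const_lt hlt] with x hx
      exact hx.trans_le (tsum_iInf_mul_le _ g hh)
    · have hlim : Tendsto (fun h => ENNReal.ofReal c * (G + (upperSum g h - lowerSum g h)))
          (𝓝[>] 0) (𝓝 (ENNReal.ofReal c * (G + 0))) :=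
        ENNReal.Tendsto.const_mul (tendsto_const_nhds.add hdiff) (Or.inr ENNReal.ofReal_ne_top)
      rw [add_zero] at hlim
      obtain ⟨h, hhr, hh⟩ := ((hlim.eventually_lt_const hr).and self_mem_nhdsWithin).exists
      have hupp : upperSum g h ≤ G + (upperSum g h - lowerSum g h) :=
        (hle h hh).trans (by gcongr; exact lowerSum_le_lintegral g hh)
      have hlt : ENNReal.ofReal c * upperSum g h < r := lt_of_le_of_lt (by gcongr) hhr
      have := tendsto_tsum_mul_measure hc hν hbound hh (hup h hh)
        (S := fun n => Ico (n * h) ((n + 1) * h)) (fun n => measurableSet_Ico)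
        (fun n => Ioo_subset_Ico_self) fun n => Ico_subset_Icc_self
      filter_upwards [this.eventually_lt_const hlt] with x hx
      exact (le_tsum_iSup_mul _ g hh).trans_lt hx
  have := (ENNReal.tendsto_toReal (ENNReal.mul_ne_top ENNReal.ofReal_ne_top hGfin)).comp main
  rw [ENNReal.toReal_mul, ENNReal.toReal_ofReal hc] at this
  rw [integral_eq_lintegral_of_nonneg_ae (hnn _) hg.aestronglyMeasurable]
  refine this.congr fun x => ?_
  rw [integral_eq_lintegral_of_nonneg_ae (hnn _) hg.aestronglyMeasurable]
  rfl

/-- Only `⌈R / h⌉₊` cells contribute, each with oscillation at most `h`, so the Riemann sums differ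
by at most `(R / h + 1) * h * h`. -/
lemma DirectlyRiemannIntegrable.of_lipschitz {g : ℝ → ℝ} (hg0 : ∀ t, 0 ≤ g t)
    (hg1 : ∀ t, g t ≤ 1) (hlip : ∀ s t, g s ≤ g t + |s - t|) {R : ℝ} (hR : 0 ≤ R)
    (hgR : ∀ t, R ≤ t → g t = 0) : DirectlyRiemannIntegrable g := by
  have hzero : ∀ h, 0 < h → ∀ n : ℕ, n ∉ Finset.range ⌈R / h⌉₊ →
      ⨆ y ∈ Ico (n * h) ((n + 1) * h), ENNReal.ofReal (g y) = 0 := by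
    intro h hh n hn
    simp only [ENNReal.iSup_eq_zero]
    intro y hy
    rw [Finset.mem_range, not_lt] at hn
    have h1 := (Nat.le_ceil (R / h)).trans (Nat.cast_le.2 hn)
    rw [div_le_iff₀ hh] at h1
    rw [hgR y (h1.trans hy.1), ENNReal.ofReal_zero]
  refine ⟨fun t _ => hg0 t, fun h hh => ?_, ?_⟩
  · rw [upperSum, tsum_eq_sum (s := Finset.range ⌈R / h⌉₊)
      fun n hn => by rw [hzero h hh n hn, mul_zero]]
    refine ENNReal.sum_lt_top.2 fun n _ => ENNReal.mul_lt_top ENNReal.ofReal_lt_top ?_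
    refine lt_of_le_of_lt (iSup₂_le fun y _ => ?_) ENNReal.one_lt_top
    exact ENNReal.ofReal_le_one.2 (hg1 y)
  · have hbd : ∀ h, 0 < h → upperSum g h - lowerSum g h ≤ ENNReal.ofReal ((R + h) * h) := by
      intro h hh
      rw [tsub_le_iff_left]
      have hterm : ∀ n : ℕ, ENNReal.ofReal h *
          ⨆ y ∈ Ico (n * h) ((n + 1) * h), ENNReal.ofReal (g y) ≤
          (ENNReal.ofReal h * ⨅ y ∈ Ico (n * h) ((n + 1) * h), ENNReal.ofReal (g y)) +
            if n ∈ Finset.range ⌈R / h⌉₊ then ENNReal.ofReal (h * h) else 0 := by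
        intro n
        by_cases hn : n ∈ Finset.range ⌈R / h⌉₊
        · rw [if_pos hn, ENNReal.ofReal_mul hh.le, ← mul_add]
          gcongr
          refine iSup₂_le fun y hy => tsub_le_iff_right.1 (le_iInf₂ fun y' hy' => ?_)
          rw [tsub_le_iff_right, ← ENNReal.ofReal_add (hg0 _) hh.le]
          refine ENNReal.ofReal_le_ofReal ((hlip y y').trans ?_)
          gcongr
          rw [abs_le]
          constructor <;> linarith [hy.1, hy.2, hy'.1, hy'.2]
        · rw [hzero h hh n hn, mul_zero]; exact zero_le
      refine (ENNReal.tsum_le_tsum hterm).trans ?_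
      rw [ENNReal.tsum_add]
      refine add_le_add le_rfl ?_
      rw [tsum_eq_sum (s := Finset.range ⌈R / h⌉₊) fun n hn => if_neg hn,
        Finset.sum_congr rfl fun n hn => if_pos hn, Finset.sum_const, Finset.card_range,
        nsmul_eq_mul, ← ENNReal.ofReal_natCast, ← ENNReal.ofReal_mul (by positivity)]
      refine ENNReal.ofReal_le_ofReal ?_
      have := (Nat.ceil_lt_add_one (div_nonneg hR hh.le)).le
      calc (⌈R / h⌉₊ : ℝ) * (h * h) ≤ (R / h + 1) * (h * h) := by gcongr
        _ = (R + h) * h := by field_simp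
    have hlim : Tendsto (fun h : ℝ => ENNReal.ofReal ((R + h) * h)) (𝓝[>] 0) (𝓝 0) := by
      have : Continuous fun h : ℝ => (R + h) * h := by fun_prop
      have := ENNReal.tendsto_ofReal (this.tendsto 0)
      simp only [mul_zero, ENNReal.ofReal_zero] at this
      exact tendsto_nhdsWithin_of_tendsto_nhds this
    refine tendsto_of_tendsto_of_tendsto_of_le_of_le' tendsto_const_nhds hlim
      (.of_forall fun h => zero_le) ?_
    filter_upwards [self_mem_nhdsWithin] with h hh
    exact hbd h hh

end directRiemann

/-! ### Long tails and the asymptotics of the ladder law -/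

section longTailed

open scoped ENNReal NNReal

/-- As `U` lives on `(-∞, 0]`, the sum can reach `[s, s + ℓ]` only from a first summand at least
`s`. -/
lemma conv_apply_Icc_le (μ : Measure ℝ) {U : Measure ℝ} [SFinite U] {ℓ : ℝ} {C : ℝ≥0} (hC : ∀ s, U (Icc s (s + ℓ)) ≤ C)
    (hUneg : ∀ᵐ x ∂U, x ∈ Iic (0 : ℝ)) (s : ℝ) : (μ ∗ U) (Icc s (s + ℓ)) ≤ C * μ (Ici s) := by
  rw [conv_apply_eq_lintegral _ _ measurableSet_Icc, ← setLIntegral_const,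
    ← lintegral_indicator measurableSet_Ici]
  refine lintegral_mono fun w => ?_
  by_cases hw : w ∈ Ici s
  · rw [indicator_of_mem hw]
    refine le_trans (measure_mono fun u hu => ?_) (hC (s - w))
    exact ⟨by linarith [hu.1], by linarith [hu.2]⟩
  · rw [indicator_of_notMem hw, nonpos_iff_eq_zero]
    refine measure_mono_null (fun u hu => ?_) hUneg
    rw [mem_Ici, not_le] at hw
    exact not_le.2 (show 0 < u by linarith [hu.1])

variable {μ : Measure ℝ} [IsProbabilityMeasure μ]

lemma LongTailed.rightTail_pos (hμ : LongTailed μ) {x : ℝ} (hx : 0 < x) : 0 < rightTail μ x :=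
  ENNReal.toReal_pos (hμ.1 x hx).1.ne' (measure_ne_top _ _)

/-- Under a long-tailed law the overshoot of a high level tends to infinity. -/
lemma LongTailed.tendsto_integral_div (hμ : LongTailed μ) {ψ : ℝ → ℝ} {B R : ℝ}
    (hB : ∀ t, |ψ t| ≤ B) (hR : ∀ t, t < -R → ψ t = 0) (hψ0 : Tendsto ψ atTop (𝓝 0)) :
    Tendsto (fun x => (∫ w, ψ (w - x) ∂μ) / rightTail μ x) atTop (𝓝 0) := by
  have hB0 : 0 ≤ B := (abs_nonneg _).trans (hB 0)
  refine Metric.tendsto_nhds.2 fun ε hε => ?_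
  obtain ⟨T₀, hT₀⟩ := eventually_atTop.1 (Metric.tendsto_nhds.1 hψ0 (ε / 2) (half_pos hε))
  -- Beyond `x + T` the integrand is small; between `x - R - 1` and `x + T` the mass is a difference
  -- of asymptotically equal tails. The extra `1` covers `-R` itself, since `Ioc` omits its left
  -- end.
  set T := max T₀ (-R - 1) with hT
  have hTR : -R - 1 ≤ T := le_max_right _ _
  have hlim : Tendsto (fun x => B * (rightTail μ (x + (-R - 1)) / rightTail μ x -
      rightTail μ (x + T) / rightTail μ x) + ε / 2 * (rightTail μ (x + T) / rightTail μ x)) atTop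
      (𝓝 (B * (1 - 1) + ε / 2 * 1)) :=
    (((hμ.2 _).sub (hμ.2 _)).const_mul B).add ((hμ.2 _).const_mul (ε / 2))
  have hlt : B * (1 - 1) + ε / 2 * 1 < ε := by linarith
  filter_upwards [hlim.eventually_lt_const hlt, eventually_gt_atTop 0] with x hx hx0
  have hpos := hμ.rightTail_pos hx0
  rw [dist_zero_right, norm_div, Real.norm_of_nonneg hpos.le]
  refine lt_of_le_of_lt ?_ hx
  rw [div_le_iff₀ hpos]
  have hsub : Ioi (x + T) ⊆ Ioi (x + (-R - 1)) := Ioi_subset_Ioi (by linarith)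
  have hdiff : μ.real (Ioc (x + (-R - 1)) (x + T)) =
      rightTail μ (x + (-R - 1)) - rightTail μ (x + T) := by
    rw [← Ioi_sdiff_Ioi, measureReal_sdiff hsub measurableSet_Ioi]
    rfl
  calc ‖∫ w, ψ (w - x) ∂μ‖ ≤ ∫ w, (Ioc (x + (-R - 1)) (x + T)).indicator (fun _ => B) w +
          (Ioi (x + T)).indicator (fun _ => ε / 2) w ∂μ := by
        refine norm_integral_le_of_norm_le (((integrable_const B).indicator measurableSet_Ioc).add
          ((integrable_const (ε / 2)).indicator measurableSet_Ioi)) (.of_forall fun w => ?_)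
        by_cases h1 : w ∈ Ioi (x + T)
        · rw [indicator_of_notMem (fun h => not_lt.2 h.2 h1), indicator_of_mem h1, zero_add]
          have := hT₀ (w - x) (by
            have : x + T < w := h1
            linarith [le_max_left T₀ (-R - 1)])
          rw [dist_zero_right] at this
          exact this.le
        · rw [indicator_of_notMem h1, add_zero]
          by_cases h2 : w ∈ Ioc (x + (-R - 1)) (x + T)
          · rw [indicator_of_mem h2]; exact hB _
          · rw [indicator_of_notMem h2, hR, norm_zero]
            rw [mem_Ioi, not_lt] at h1
            by_contra! hcon
            exact h2 ⟨by linarith, h1⟩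
    _ = B * (rightTail μ (x + (-R - 1)) - rightTail μ (x + T)) + ε / 2 * rightTail μ (x + T) := by
        rw [integral_add ((integrable_const B).indicator measurableSet_Ioc)
          ((integrable_const (ε / 2)).indicator measurableSet_Ioi),
          integral_indicator_const _ measurableSet_Ioc, integral_indicator_const _ measurableSet_Ioi,
          hdiff, smul_eq_mul, smul_eq_mul, rightTail, rightTail]
        ring
    _ = _ := by field_simp

variable {U : Measure ℝ} [SFinite U]

lemma UniformlyLocallyFinite.conv (hU : UniformlyLocallyFinite U) :
    UniformlyLocallyFinite (μ ∗ U) := by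
  intro ℓ
  obtain ⟨C, hC⟩ := hU ℓ
  refine ⟨C, fun s => ?_⟩
  rw [conv_apply_eq_lintegral _ _ measurableSet_Icc]
  calc _ ≤ ∫⁻ _, C ∂μ := lintegral_mono fun w => by
        refine le_trans (measure_mono fun u hu => ?_) (hC (s - w))
        exact ⟨by linarith [hu.1], by linarith [hu.2]⟩
    _ = C := by simp

lemma LongTailed.exists_measure_Icc_le (hμ : LongTailed μ) (hU : UniformlyLocallyFinite U)
    (hUneg : ∀ᵐ x ∂U, x ∈ Iic (0 : ℝ)) (ℓ : ℝ) :
    ∃ C : ℝ≥0, ∀ᶠ x in atTop, ∀ a, 0 ≤ a →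
      (μ ∗ U) (Icc (x + a) (x + a + ℓ)) ≤ C * ENNReal.ofReal (rightTail μ x) := by
  obtain ⟨C, hC⟩ := hU ℓ
  -- The factor `2` bounds `rightTail μ (x - 1) / rightTail μ x`; the shift by `1` replaces the
  -- closed ray at `x + a` by an open one, even for `a = 0`.
  refine ⟨C * 2, ?_⟩
  filter_upwards [(hμ.2 (-1)).eventually_lt_const one_lt_two, eventually_gt_atTop 0]
    with x hx hx0 a ha
  refine (conv_apply_Icc_le μ hC hUneg _).trans ?_
  push_cast
  rw [mul_assoc]
  gcongr
  have h2 : μ (Ioi (x + -1)) = ENNReal.ofReal (rightTail μ (x + -1)) := (ofReal_measureReal).symm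
  calc μ (Ici (x + a)) ≤ μ (Ioi (x + -1)) := measure_mono (Ici_subset_Ioi.2 (by linarith))
    _ ≤ ENNReal.ofReal (2 * rightTail μ x) := by
        rw [h2]
        refine ENNReal.ofReal_le_ofReal ?_
        rw [div_lt_iff₀ (hμ.rightTail_pos hx0)] at hx
        exact hx.le
    _ = _ := by rw [ENNReal.ofReal_mul zero_le_two]; simp

/-- The local asymptotics of `μ ∗ U` for a long-tailed law `μ` and a measure `U` on `(-∞, 0]`
satisfying the renewal theorem. -/
lemma LongTailed.tendsto_integral_conv_div (hμ : LongTailed μ) (hU : UniformlyLocallyFinite U)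
    (hUneg : ∀ᵐ x ∂U, x ∈ Iic (0 : ℝ)) {z : ℝ → ℝ} (hz : Continuous z) (hc : HasCompactSupport z)
    {κ : ℝ} (hκ : Tendsto (fun t => ∫ u, z (t + u) ∂U) atTop (𝓝 κ)) :
    Tendsto (fun x => (∫ y in Ioi 0, z (y - x) ∂(μ ∗ U)) / rightTail μ x) atTop (𝓝 κ) := by
  have := hU.isFiniteMeasureOnCompacts
  have := (hU.conv (μ := μ)).isFiniteMeasureOnCompacts
  obtain ⟨R, hR, hR0⟩ := exists_eq_zero_of_abs_gt hc
  obtain ⟨B, hB⟩ := exists_abs_integral_add_le hU hz hc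
  have hZc := (uniformContinuous_integral_add hU hz hc).continuous
  set Z := fun t => ∫ u, z (t + u) ∂U with hZ
  -- Subtracting the limiting step function leaves a bounded remainder that vanishes to the left of
  -- `-R` and tends to `0` at infinity; the step itself contributes exactly `κ * rightTail μ x`.
  set ψ := fun t => Z t - (Ioi 0).indicator (fun _ => κ) t with hψ
  have h1 : Tendsto (fun x => (∫ w, ψ (w - x) ∂μ) / rightTail μ x) atTop (𝓝 0) := by
    refine hμ.tendsto_integral_div (B := B + |κ|) (R := R) (fun t => ?_)
      (fun t ht => ?_) ?_
    · refine (abs_sub _ _).trans (add_le_add (hB t) ?_)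
      by_cases h : t ∈ Ioi (0 : ℝ) <;> simp [h]
    · have hZt : Z t = 0 := by
        refine integral_eq_zero_of_ae ?_
        filter_upwards [hUneg] with u hu
        have hu' : u ≤ 0 := hu
        refine hR0 _ ?_
        rw [abs_of_neg (by linarith)]
        linarith
      have ht' : t ∉ Ioi (0 : ℝ) := by rw [mem_Ioi, not_lt]; linarith
      simp only [hψ, hZt, indicator_of_notMem ht', sub_zero]
    · have := hκ.sub_const κ
      rw [sub_self] at this
      refine this.congr' ?_
      filter_upwards [eventually_gt_atTop 0] with t ht
      simp only [hψ, indicator_of_mem (mem_Ioi.2 ht)]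
  have h2 := h1.add_const κ
  rw [zero_add] at h2
  refine h2.congr' ?_
  -- For `x > R` the translate of `z` vanishes off `(0, ∞)`, so the restriction to `(0, ∞)` costs
  -- nothing.
  filter_upwards [eventually_gt_atTop R] with x hx
  have hpos := hμ.rightTail_pos (hR.trans hx)
  have hi : Integrable (fun y => z (-x + y)) (μ ∗ U) := integrable_comp_add hz hc (-x)
  have e1 : ∫ y in Ioi 0, z (y - x) ∂(μ ∗ U) = ∫ w, Z (w - x) ∂μ := by
    rw [setIntegral_eq_integral_of_forall_compl_eq_zero fun y hy => hR0 _ ?_]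
    · have : (fun y => z (y - x)) = fun y => z (-x + y) := by ext y; congr 1; ring
      rw [this, integral_conv hi]
      refine integral_congr_ae (.of_forall fun w => integral_congr_ae (.of_forall fun u => ?_))
      simp only []
      congr 1; ring
    · rw [mem_Ioi, not_lt] at hy
      rw [abs_of_neg (by linarith)]
      linarith
  have hZi : Integrable (fun w => Z (w - x)) μ :=
    .of_bound (hZc.comp (continuous_sub_right x)).aestronglyMeasurable B (.of_forall fun w => hB _)
  have e3 : (fun w => (Ioi 0).indicator (fun _ => κ) (w - x)) = (Ioi x).indicator fun _ => κ := by
    ext w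
    simp only [indicator, mem_Ioi, sub_pos]
  have e2 : ∫ w, ψ (w - x) ∂μ = ∫ w, Z (w - x) ∂μ - κ * rightTail μ x := by
    have hI : Integrable (fun w => (Ioi 0).indicator (fun _ => κ) (w - x)) μ := by
      rw [e3]; exact (integrable_const κ).indicator measurableSet_Ioi
    simp only [hψ]
    rw [integral_sub hZi hI, e3, integral_indicator_const _ measurableSet_Ioi, smul_eq_mul,
      mul_comm, rightTail]
  rw [e1, e2, sub_div, mul_div_cancel_right₀ _ hpos.ne']
  ring

lemma LongTailed.tendsto_integral_of_directlyRiemannIntegrable (hμ : LongTailed μ)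
    (hU : UniformlyLocallyFinite U) (hUneg : ∀ᵐ x ∂U, x ∈ Iic (0 : ℝ)) {c : ℝ} (hc : 0 ≤ c)
    (hren : ∀ z : ℝ → ℝ, Continuous z → HasCompactSupport z → (∀ t, 0 ≤ z t) →
      Tendsto (fun t => ∫ u, z (t + u) ∂U) atTop (𝓝 (c * ∫ t, z t)))
    {L : Measure ℝ} [IsFiniteMeasure L] (hL : L = (μ ∗ U).restrict (Ioi 0))
    {g : ℝ → ℝ} (hg : Measurable g) (hgR : DirectlyRiemannIntegrable g) :
    Tendsto (fun x => 1 / rightTail μ x * ∫ y in Ioi x, g (y - x) ∂L) atTop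
      (𝓝 (c * ∫ y in Ioi 0, g y)) := by
  have hmap : ∀ x : ℝ, Measurable fun y : ℝ => y - x := fun x => measurable_sub_const x
  -- The ladder law seen from level `x` and normalised by the tail; it converges vaguely to `c`
  -- times Lebesgue measure on the test functions.
  set ν : ℝ → Measure ℝ := fun x =>
    ((1 / rightTail μ x).toNNReal) • L.map fun y => y - x with hνdef
  have hnn : ∀ x, 0 ≤ 1 / rightTail μ x := fun x => one_div_nonneg.2 measureReal_nonneg
  have hfin : ∀ x, IsFiniteMeasure (ν x) := fun x => by
    rw [hνdef]; infer_instance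
  have hint : ∀ (x : ℝ) (S : Set ℝ) (f : ℝ → ℝ), MeasurableSet S → Measurable f →
      ∫ y in S, f y ∂ν x = 1 / rightTail μ x * ∫ y in (fun y => y - x) ⁻¹' S, f (y - x) ∂L := by
    intro x S f hS hf
    rw [hνdef, Measure.restrict_smul, integral_smul_nnreal_measure,
      setIntegral_map hS hf.aestronglyMeasurable (hmap x).aemeasurable, NNReal.smul_def,
      Real.coe_toNNReal _ (hnn x), smul_eq_mul]
  have hpre : ∀ x : ℝ, (fun y => y - x) ⁻¹' Ioi 0 = Ioi x := fun x => by
    ext y; simp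
  refine (_root_.tendsto_integral_of_directlyRiemannIntegrable (ν := ν) hc ?_ ?_ hg hgR).congr
    fun x => by rw [hint x _ _ measurableSet_Ioi hg, hpre]
  · intro z hz hzc hz0
    refine (hμ.tendsto_integral_conv_div hU hUneg hz hzc (hren z hz hzc hz0)).congr fun x => ?_
    have := hint x univ z .univ hz.measurable
    rw [Measure.restrict_univ, preimage_univ, Measure.restrict_univ] at this
    rw [this, hL, div_eq_mul_inv, mul_comm, one_div]
  · intro ℓ
    obtain ⟨C, hC⟩ := hμ.exists_measure_Icc_le hU hUneg ℓ
    refine ⟨C, ?_⟩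
    filter_upwards [hC, eventually_gt_atTop 0] with x hx hx0 a ha
    have hpos := hμ.rightTail_pos hx0
    have hpre' : (fun y => y - x) ⁻¹' Icc a (a + ℓ) = Icc (x + a) (x + a + ℓ) := by
      ext y
      simp only [mem_preimage, mem_Icc]
      constructor <;> rintro ⟨h1, h2⟩ <;> constructor <;> linarith
    rw [hνdef, Measure.smul_apply, Measure.map_apply (hmap x) measurableSet_Icc, hpre', hL]
    calc _ ≤ ENNReal.ofReal (1 / rightTail μ x) * (C * ENNReal.ofReal (rightTail μ x)) := by
          change ENNReal.ofReal (1 / rightTail μ x) * _ ≤ _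
          gcongr
          exact (Measure.restrict_apply_le _ _).trans (hx a ha)
      _ = C * ENNReal.ofReal (1 / rightTail μ x * rightTail μ x) := by
          rw [ENNReal.ofReal_mul (hnn x)]; ring
      _ = C := by rw [one_div_mul_cancel hpos.ne']; simp

/-- A continuous directly Riemann integrable function supported in `[0, 2]`. -/
def tent (t : ℝ) : ℝ := max 0 (1 - |t - 1|)

lemma tent_nonneg (t : ℝ) : 0 ≤ tent t := le_max_left _ _

lemma continuous_tent : Continuous tent := by unfold tent; fun_prop

lemma tent_of_nonpos {t : ℝ} (ht : t ≤ 0) : tent t = 0 :=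
  max_eq_left (by rw [abs_of_neg (by linarith)]; linarith)

lemma tent_of_two_le {t : ℝ} (ht : 2 ≤ t) : tent t = 0 :=
  max_eq_left (by rw [abs_of_nonneg (by linarith)]; linarith)

lemma directlyRiemannIntegrable_tent_sub {s : ℝ} (hs : 0 ≤ s) :
    DirectlyRiemannIntegrable fun t => tent (t - s) := by
  refine .of_lipschitz (R := s + 2) (fun t => tent_nonneg _)
    (fun t => max_le zero_le_one (by linarith [abs_nonneg (t - s - 1)])) (fun a b => ?_)
    (by linarith) fun t ht => tent_of_two_le (by linarith)
  refine max_le (add_nonneg (tent_nonneg _) (abs_nonneg _)) ?_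
  have h1 : 1 - |b - s - 1| ≤ tent (b - s) := le_max_right _ _
  have h2 : |b - s - 1| ≤ |a - s - 1| + |a - b| := by
    rw [show b - s - 1 = (a - s - 1) - (a - b) by ring]; exact abs_sub _ _
  linarith

lemma setIntegral_tent_sub {s x : ℝ} (hs : x ≤ s) (ρ : Measure ℝ) :
    ∫ t in Ioi x, tent (t - s) ∂ρ = ∫ t, tent (t - s) ∂ρ :=
  setIntegral_eq_integral_of_forall_compl_eq_zero fun t ht =>
    tent_of_nonpos (by rw [mem_Ioi, not_lt] at ht; linarith)

lemma integral_tent_pos : 0 < ∫ t, tent t := by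
  refine continuous_tent.integral_pos_of_hasCompactSupport_nonneg_nonzero
    (.intro (isCompact_Icc (a := (0 : ℝ)) (b := 2)) fun t ht => ?_) tent_nonneg (x := 1) ?_
  · rw [mem_Icc, not_and_or, not_le, not_le] at ht
    exact ht.elim (fun h => tent_of_nonpos h.le) fun h => tent_of_two_le h.le
  · simp [tent]

-- The tent mass `J (x + t)` divided by the tail at `x`, and by the tail at `x + t`, has the same
-- positive limit; the quotient is the tail ratio. Only `t ≥ 0` is accessible, since `g` is seen on
-- `[0, ∞)`.
omit [SFinite U] in
lemma longTailed_of_tendsto {L : Measure ℝ} {c : ℝ} (hc : 0 < c)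
    (hlim : ∀ g : ℝ → ℝ, Measurable g → DirectlyRiemannIntegrable g →
      Tendsto (fun x => 1 / rightTail μ x * ∫ y in Ioi x, g (y - x) ∂L) atTop
        (𝓝 (c * ∫ z in Ioi 0, g z))) : LongTailed μ := by
  set J : ℝ → ℝ := fun x => ∫ y, tent (y - x) ∂L with hJ
  set κ := c * ∫ t, tent t with hκdef
  have hκ : 0 < κ := mul_pos hc integral_tent_pos
  have hshift : ∀ s, 0 ≤ s →
      Tendsto (fun x => 1 / rightTail μ x * J (x + s)) atTop (𝓝 κ) := by
    intro s hs
    have h := hlim (fun t => tent (t - s)) (continuous_tent.measurable.comp (measurable_sub_const s))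
      (directlyRiemannIntegrable_tent_sub hs)
    rw [setIntegral_tent_sub hs, integral_sub_right_eq_self (fun t => tent t)] at h
    refine h.congr fun x => ?_
    have : (fun y => tent (y - x - s)) = fun y => tent (y - (x + s)) := by
      ext y; congr 1; ring
    simp only [this]
    rw [setIntegral_tent_sub (by linarith)]
  -- A vanishing tail would make the normalised quantity `0`, because `1 / 0 = 0`, against its
  -- positive limit.
  have hpos : ∀ x, 0 < rightTail μ x := by
    intro x
    obtain ⟨y, hy1, hy2⟩ := (((hshift 0 le_rfl).eventually_const_lt hκ).and
      (eventually_ge_atTop x)).exists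
    have hy0 : rightTail μ y ≠ 0 := by
      intro h
      rw [h] at hy1
      simp at hy1
    exact (measureReal_nonneg.lt_of_ne' hy0).trans_le (measureReal_mono (Ioi_subset_Ioi hy2))
  have hright : ∀ t, 0 ≤ t → Tendsto (fun x => rightTail μ (x + t) / rightTail μ x) atTop (𝓝 1) := by
    intro t ht
    have h1 := hshift t ht
    have h2 := (hshift 0 le_rfl).comp (tendsto_atTop_add_const_right atTop t tendsto_id)
    have h3 := h1.div h2 hκ.ne'
    rw [div_self hκ.ne'] at h3
    refine h3.congr' ?_
    filter_upwards [h2.eventually_const_lt hκ] with x hx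
    simp only [Function.comp, id, add_zero] at hx
    have hJ0 : J (x + t) ≠ 0 := by
      intro h; rw [h, mul_zero] at hx; exact lt_irrefl _ hx
    have := (hpos x).ne'
    have := (hpos (x + t)).ne'
    simp only [Pi.div_apply, Function.comp, id, add_zero]
    field_simp
  refine ⟨fun x _ => ⟨?_, measure_lt_top _ _⟩, fun t => ?_⟩
  · exact (ENNReal.toReal_pos_iff.1 (hpos x)).1
  · rcases le_total 0 t with ht | ht
    · exact hright t ht
    -- A negative shift is the inverse of the ratio for `-t` taken at `x + t`.
    · have h1 := ((hright (-t) (by linarith)).comp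
        (tendsto_atTop_add_const_right atTop t tendsto_id)).inv₀ one_ne_zero
      rw [inv_one] at h1
      refine h1.congr fun x => ?_
      simp

end longTailed

/-! ### The equivalence -/

theorem mainTheorem10 {Ω : Type*} [MeasurableSpace Ω] (P : Measure Ω) [IsProbabilityMeasure P]
    (X : ℕ → Ω → ℝ) (hmeas : ∀ n, Measurable (X n)) (hindep : iIndepFun X P)
    (hident : ∀ n, IdentDistrib (X n) (X 0) P P)
    (hfin : ∀ᵐ ω ∂P, descEpoch X ω < ⊤) (hmean : Integrable (descHeight X) P)
    (hnl : NonLattice (P.map (X 0))) :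
    LongTailed (P.map (X 0)) ↔
      ∀ g : ℝ → ℝ, Measurable g → DirectlyRiemannIntegrable g →
        Tendsto
          (fun x : ℝ => 1 / rightTail (P.map (X 0)) x *
            ∫ y in Ioi x, g (y - x) ∂(ascLadderLaw P X))
          atTop (𝓝 (1 / (∫ ω, descHeight X ω ∂P) * ∫ z in Ioi 0, g z)) := by
  set μ := P.map (X 0) with hμ
  have hprob : IsProbabilityMeasure μ := Measure.isProbabilityMeasure_map (hmeas 0).aemeasurable
  have hH := measurable_descHeight hmeas
  have hdesc := map_neg_descHeight_eq_exitLaw hmeas hindep hident hfin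
  set h := exitLaw μ (Iic 0) with hh
  have hhprob : IsProbabilityMeasure h := by
    rw [← hdesc]; exact Measure.isProbabilityMeasure_map hH.neg.aemeasurable
  have hhnl : NonLattice h := nonLattice_exitLaw μ hnl
  have hneg : ∀ᵐ x ∂h, x ∈ Iic (0 : ℝ) := ae_exitLaw_nonpos μ
  have hint : Integrable id h := by
    rw [← hdesc]
    exact (integrable_map_measure aestronglyMeasurable_id hH.neg.aemeasurable).2 hmean.neg
  have hm : ∫ ω, descHeight X ω ∂P = -∫ x, x ∂h := by
    have := integral_map (μ := P) (φ := fun ω => -descHeight X ω) (f := fun x : ℝ => x)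
      hH.neg.aemeasurable aestronglyMeasurable_id
    rw [← hdesc, this, integral_neg, neg_neg]
  -- Otherwise `h` would be the point mass at `0`, which is lattice; this makes the mean `m`
  -- strictly positive.
  have h0 : h (Iio 0) ≠ 0 := by
    intro h0
    refine hhnl ⟨1, one_pos, ?_⟩
    have h0' : ∀ᵐ x ∂h, x ∉ Iio (0 : ℝ) := measure_eq_zero_iff_ae_notMem.1 h0
    filter_upwards [hneg, h0'] with x hx1 hx2
    exact ⟨0, by simpa using le_antisymm hx1 (not_lt.1 hx2)⟩
  have hmneg : ∫ x, x ∂h < 0 := by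
    have : 0 < ∫ x, -x ∂h := by
      refine (integral_pos_iff_support_of_nonneg_ae (hneg.mono fun x hx => by simpa using hx)
        hint.neg).2 ?_
      exact (pos_iff_ne_zero.2 h0).trans_le (measure_mono fun x hx => by
        simpa using (mem_Iio.1 hx).ne)
    rw [integral_neg] at this
    linarith
  have hc : 0 < 1 / ∫ ω, descHeight X ω ∂P := by rw [hm]; exact one_div_pos.2 (by linarith)
  refine ⟨fun hlong g hg hgR => ?_, longTailed_of_tendsto hc⟩
  have hU := uniformlyLocallyFinite_occupation μ h0
  have hL : ascLadderLaw P X = (μ ∗ occupation μ).restrict (Ioi 0) := by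
    rw [ascLadderLaw_eq_exitLaw hmeas hindep hident, exitLaw_Ioi, Measure.conv_comm]
  have hLfin : IsFiniteMeasure (ascLadderLaw P X) := by unfold ascLadderLaw; infer_instance
  refine hlong.tendsto_integral_of_directlyRiemannIntegrable hU (ae_occupation_nonpos μ) hc.le
    (fun z hz hzc hz0 => ?_) hL hg hgR
  have := tendsto_integral_add hhnl hneg hint hmneg hU (ae_occupation_nonpos μ)
    (occupation_eq μ) hz hzc hz0
  rwa [hm, one_div_mul_eq_div]
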